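/- For a closed set $K\subseteq\mathbf R^2$ let $\delta_K(x)=\inf\{|x-a|:a\in K\}$ be the distance function, $S(K,r)=\{x:\delta_K(x)=r\}$ for $r>0$, $\xi_K(x)=\{a\in K:|x-a|=\delta_K(x)\}$ the (multivalued) nearest point projection, $N(K)=\{(a,u):a\in K,\ |u|=1,\ \delta_K(a+su)=s\text{ for some }s>0\}\subseteq\mathbf R^2\times\mathbf R^2$ the unit normal bundle, and $N(K)|S=\{(a,u)\in N(K):a\in S\}$. Let $\Sigma_2(K)$ be the set of $x\in\mathbf R^2\setminus K$ at which $\delta_K$ is not pointwise twice differentiable, i.e. for which there is no polynomial $P$ of degree at most $2$ with $P(x)=\delta_K(x)$ and $\lim_{y\to x}|\delta_K(y)-P(y)|/|y-x|^2=0$. A multivalued map $T$ is differentiable at $x$ if $T(x)=\{p\}$ is a singleton and there is a linear map $L$ such that for every $\varepsilon>0$ there is $\delta>0$ with $|q-p-L(y-x)|\le\varepsilon|y-x|$ whenever $|y-x|\le\delta$ and $q\in T(y)$; it is directionally differentiable at $x$ if $T(x)=\{p\}$ is a singleton and for every $v$ there is $w$ such that for every $\varepsilon>0$ there is $\delta>0$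 with $|q-p-tw|\le\varepsilon t$ whenever $0<t\le\delta$ and $q\in T(x+tv)$. The restriction $T|A$ equals $T$ on $A$ and is empty-valued off $A$. For each $s\ge0$, $\mathscr H^s$ is the $s$-dimensional Hausdorff measure. **Theorem.** There exist a closed convex set $K\subseteq\mathbf R^2$ with $\mathcal C^{1,1}$ boundary and a dense subset $S$ of $\partial K$ such that 1. $\mathscr H^1(S)=0$ and $\mathscr H^s(S)=+\infty$ for all $0\le s<1$; 2. $\mathscr H^1(N(K)|S)=0$ and $\mathscr H^s(N(K)|S)=+\infty$ for all $0\le s<1$; 3. for all $r>0$ and $(a,u)\in N(K)|S$, the map $\xi_K|S(K,r)$ is not differentiable at $a+ru$; 4. both $\Sigma_2(K)$ and the set of points of $\mathbf R^2\setminus K$ at which $\xi_K$ is not directionally differentiable are dense in $\mathbf R^2\setminus K$ and have Hausdorff dimension $2$. Here $K$ has $\mathcal C^{1,1}$ boundary if near each point of $\partial K$, in suitable orthonormal coordinates, $K$ is the epigraph $\{(x,y):g(x)\le y\}$ of a differentiable function $g:\mathbf R\to\mathbf R$ with Lipschitz derivative. -/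

import Mathlib

open Set Filter Topology MeasureTheory Metric Asymptotics

/-- The Euclidean plane. -/
abbrev Plane : Type := EuclideanSpace ℝ (Fin 2)

/-- `g : ℝ → ℝ` is of class `C^{1,1}`: differentiable, with Lipschitz derivative. -/
def IsC11 (g : ℝ → ℝ) : Prop :=
  Differentiable ℝ g ∧ ∃ L : NNReal, LipschitzWith L (deriv g)

/-- `K ⊆ ℝ²` has `C^{1,1}` boundary: near every boundary point, in suitable orthonormal
coordinates, `K` is the epigraph of a `C^{1,1}` function. -/
def HasC11Boundary (K : Set Plane) : Prop :=
  ∀ p ∈ frontier K, ∃ (T : Plane ≃ₗᵢ[ℝ] Plane) (g : ℝ → ℝ), IsC11 g ∧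
    ∀ᶠ x in 𝓝 p, (x ∈ K ↔ g (T x 0) ≤ T x 1)

section General

variable {E F : Type*} [NormedAddCommGroup E] [NormedSpace ℝ E]
  [NormedAddCommGroup F] [NormedSpace ℝ F]

/-- The multivalued nearest point projection `ξ_K` onto `K`. -/
def nearestPoints (K : Set E) (x : E) : Set E :=
  {a | a ∈ K ∧ ‖x - a‖ = infDist x K}

/-- The level set `S(K, r)` of the distance function `δ_K`. -/
def distLevel (K : Set E) (r : ℝ) : Set E := {x | infDist x K = r}

/-- The restriction `T|A` of a multivalued map: it is empty-valued off `A`. -/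
def multiRestrict (T : E → Set F) (A : Set E) (x : E) : Set F := {y | x ∈ A ∧ y ∈ T x}

/-- Differentiability of a multivalued map at `a`. -/
def MultiDifferentiableAt (T : E → Set F) (a : E) : Prop :=
  ∃ p : F, T a = {p} ∧ ∃ L : E →L[ℝ] F, ∀ ε > 0, ∃ δ > 0, ∀ x, ‖x - a‖ ≤ δ →
    ∀ y ∈ T x, ‖y - p - L (x - a)‖ ≤ ε * ‖x - a‖

/-- Directional differentiability of a multivalued map at `a`: `T a` is a singleton and the
one-sided directional derivative exists in every direction `v`. -/
def MultiDirDifferentiableAt (T : E → Set F) (a : E) : Prop :=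
  ∃ p : F, T a = {p} ∧ ∀ v : E, ∃ w : F, ∀ ε > 0, ∃ δ > 0, ∀ t : ℝ, 0 < t → t ≤ δ →
    ∀ y ∈ T (a + t • v), ‖y - p - t • w‖ ≤ ε * t

/-- Pointwise differentiability of order `2` at `x`: there is a polynomial of degree at most `2`
which takes the value `f x` at `x` and approximates `f` up to `o(‖y - x‖ ^ 2)`. -/
def PointwiseTwiceDifferentiableAt (f : E → ℝ) (x : E) : Prop :=
  ∃ (L : E →L[ℝ] ℝ) (B : E →L[ℝ] E →L[ℝ] ℝ),
    (fun y => f y - (f x + L (y - x) + B (y - x) (y - x))) =o[𝓝 x] fun y => ‖y - x‖ ^ 2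

/-- `Σ₂(K)`: the points off `K` where `δ_K` is not pointwise twice differentiable. -/
def Sigma2 (K : Set E) : Set E :=
  {x | x ∉ K ∧ ¬ PointwiseTwiceDifferentiableAt (fun y => infDist y K) x}

/-- The points off `K` where `ξ_K` is not directionally differentiable. -/
def nonDirDiffPoints (K : Set E) : Set E :=
  {x | x ∉ K ∧ ¬ MultiDirDifferentiableAt (nearestPoints K) x}

/-- The unit normal bundle `N(K)`, with the Euclidean (`ℓ²`) product metric on the ambient
product. -/
def unitNormalBundle (K : Set E) : Set (WithLp 2 (E × E)) :=
  {z | z.fst ∈ K ∧ ‖z.snd‖ = 1 ∧ ∃ s : ℝ, 0 < s ∧ infDist (z.fst + s • z.snd) K = s}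

/-- The part `N(K)|S` of the unit normal bundle over base points in `S`. -/
def unitNormalBundleOver (K S : Set E) : Set (WithLp 2 (E × E)) :=
  {z | z ∈ unitNormalBundle K ∧ z.fst ∈ S}

end General

/-!
Let `F` be monotone and Lipschitz, let `g` be a primitive of `F` and let `K` be the epigraph of `g`.
The points that project to `(x, g x)` form a half-line in the direction `(F x, -1)`, so `ξ_K` is
only as regular as `F`: wherever `F` has no right derivative, `ξ_K` is not differentiable along the
level sets of `δ_K`, nor differentiable in the tangent direction. A second-order expansion of `δ_K`
would make `ξ_K` differentiable, because `y - ξ_K y` is a subgradient of the convex function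
`δ_K ^ 2 / 2`.

The set of points where `F` has no right derivative is null by Rademacher's theorem. To make it
dense and of dimension `1`, let it contain the rational translates of the Cantor sets `C` of numbers
that can be written in base `m + 1` without the digit `m`, whose dimensions
`log m / log (m + 1)` tend to `1`. In the gaps of `C`, the mean slopes of a primitive of
`1 / 2 + sin (log (dist · C)) / 2` oscillate at all scales. In a sum of such primitives with weights
`4 ^ (-k)`, consider a point and the first Cantor set that contains it: the previous terms are
differentiable at the point and the later ones are too flat to cancel the oscillation.
-/

/-- The real number `0.d₀d₁d₂…` in base `m + 1`, written without the last digit `m`. -/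
noncomputable def sparseValue {m : ℕ} (d : ℕ → Fin m) : ℝ :=
  Real.ofDigits fun k => (d k).castSucc

/-- The self-similar Cantor set of the reals in `[0, 1]` that can be written in base `m + 1`
without the last digit `m`. -/
def sparseSet (m : ℕ) : Set ℝ := range (sparseValue (m := m))

lemma isClosed_sparseSet (m : ℕ) : IsClosed (sparseSet m) :=
  (isCompact_range <| Real.continuous_ofDigits.comp <| continuous_pi fun k =>
    continuous_of_discreteTopology.comp (continuous_apply k)).isClosed

lemma zero_mem_sparseSet {m : ℕ} (hm : 0 < m) : 0 ∈ sparseSet m :=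
  ⟨fun _ => ⟨0, hm⟩, by simp [sparseValue, Real.ofDigits, Real.ofDigitsTerm]⟩

lemma sparseValue_nonneg {m : ℕ} (d : ℕ → Fin m) : 0 ≤ sparseValue d :=
  Real.ofDigits_nonneg _

lemma sparseValue_eq_sum_add {m : ℕ} (d : ℕ → Fin m) (n : ℕ) :
    sparseValue d = ∑ i ∈ Finset.range n, (d i : ℝ) * (((m : ℝ) + 1) ^ (i + 1))⁻¹ +
      (((m : ℝ) + 1) ^ n)⁻¹ * sparseValue fun i => d (i + n) := by
  simpa [sparseValue, Real.ofDigitsTerm] using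
    Real.ofDigits_eq_sum_add_ofDigits (fun k => (d k).castSucc) n

lemma sparseValue_le {m : ℕ} (d : ℕ → Fin m) : sparseValue d ≤ m / (m + 1) := by
  have hdigit : (d 0 : ℝ) + 1 ≤ m := by exact_mod_cast (d 0).2
  have htail : sparseValue (fun i => d (i + 1)) ≤ 1 := Real.ofDigits_le_one _
  have hexpand := sparseValue_eq_sum_add d 1
  simp only [Finset.range_one, Finset.sum_singleton, zero_add, pow_one] at hexpand
  rw [hexpand, mul_comm, ← mul_add, inv_mul_eq_div]
  gcongr
  linarith

lemma inv_pow_firstDiff_le_sparseValue_sub {m : ℕ} {d e : ℕ → Fin m}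
    (h : d (PiNat.firstDiff d e) < e (PiNat.firstDiff d e)) :
    (((m : ℝ) + 1) ^ (PiNat.firstDiff d e + 2))⁻¹ ≤ sparseValue e - sparseValue d := by
  set n := PiNat.firstDiff d e
  set P := (((m : ℝ) + 1) ^ (n + 1))⁻¹
  have hP : 0 < P := by positivity
  have hprefix : ∑ i ∈ Finset.range n, (d i : ℝ) * (((m : ℝ) + 1) ^ (i + 1))⁻¹ =
      ∑ i ∈ Finset.range n, (e i : ℝ) * (((m : ℝ) + 1) ^ (i + 1))⁻¹ :=
    Finset.sum_congr rfl fun i hi => by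
      rw [PiNat.apply_eq_of_lt_firstDiff (Finset.mem_range.1 hi)]
  have hdigit : ((d n : ℝ) + 1) * P ≤ e n * P := by
    gcongr
    exact_mod_cast h
  have htail_d : P * sparseValue (fun i => d (i + (n + 1))) ≤ P * (m / (m + 1)) := by
    gcongr
    exact sparseValue_le _
  have htail_e : 0 ≤ P * sparseValue (fun i => e (i + (n + 1))) :=
    mul_nonneg hP.le (sparseValue_nonneg _)
  calc (((m : ℝ) + 1) ^ (n + 2))⁻¹ = P - P * (m / (m + 1)) := by simp only [P]; field_simp; ring
    _ ≤ sparseValue e - sparseValue d := by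
      rw [sparseValue_eq_sum_add d (n + 1), sparseValue_eq_sum_add e (n + 1),
        Finset.sum_range_succ, Finset.sum_range_succ, hprefix]
      linarith

lemma inv_pow_firstDiff_le_abs_sparseValue_sub {m : ℕ} {d e : ℕ → Fin m} (hne : d ≠ e) :
    (((m : ℝ) + 1) ^ (PiNat.firstDiff d e + 2))⁻¹ ≤ |sparseValue d - sparseValue e| := by
  rcases lt_or_gt_of_ne (PiNat.apply_firstDiff_ne hne) with h | h
  · rw [abs_sub_comm]
    exact (inv_pow_firstDiff_le_sparseValue_sub h).trans (le_abs_self _)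
  · rw [PiNat.firstDiff_comm] at h ⊢
    exact (inv_pow_firstDiff_le_sparseValue_sub h).trans (le_abs_self _)

lemma sparseValue_injective {m : ℕ} : Function.Injective (sparseValue (m := m)) := by
  intro d e hde
  by_contra hne
  have hpos : 0 < (((m : ℝ) + 1) ^ (PiNat.firstDiff d e + 2))⁻¹ := by positivity
  have hsep := inv_pow_firstDiff_le_abs_sparseValue_sub hne
  rw [hde, sub_self, abs_zero] at hsep
  exact hsep.not_gt hpos

lemma sparseValue_le_of_firstDiff_le {m : ℕ} {d e : ℕ → Fin m}
    (h : d (PiNat.firstDiff d e) ≤ e (PiNat.firstDiff d e)) : sparseValue d ≤ sparseValue e := by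
  rcases eq_or_ne d e with rfl | hne
  · rfl
  · have hpos : 0 < (((m : ℝ) + 1) ^ (PiNat.firstDiff d e + 2))⁻¹ := by positivity
    linarith [inv_pow_firstDiff_le_sparseValue_sub
      (lt_of_le_of_ne h (PiNat.apply_firstDiff_ne hne))]

/-- `C` has, to the right of each of its points and at arbitrarily small scales, gaps of a length
comparable to their distance to the point. The length of the gap is written `2 * h`, so that `a` is
the point of `C` closest to every point of `[a, a + h]`. -/
def RightPorous (C : Set ℝ) : Prop :=
  ∃ M > 0, ∀ x ∈ C, ∀ δ > 0, ∃ a ∈ C, ∃ h > 0, x ≤ a ∧ a + h ≤ x + δ ∧ a - x ≤ M * h ∧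
    ∀ y ∈ C, y ≤ a ∨ a + 2 * h ≤ y

lemma RightPorous.preimage_sub_const {C : Set ℝ} (hC : RightPorous C) (q : ℝ) :
    RightPorous ((· - q) ⁻¹' C) := by
  obtain ⟨M, hM, hgaps⟩ := hC
  refine ⟨M, hM, fun x hx δ hδ => ?_⟩
  obtain ⟨a, ha, h, hh, hxa, hδa, hMa, hgap⟩ := hgaps (x - q) hx δ hδ
  refine ⟨a + q, by simpa using ha, h, hh, by linarith, by linarith, by linarith, fun y hy => ?_⟩
  exact (hgap (y - q) hy).imp (fun h => by linarith) fun h => by linarith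

lemma sparseValue_gap {m n : ℕ} {a : ℕ → Fin m} (ha : ∀ k, n ≤ k → ∀ i, i ≤ a k)
    (e : ℕ → Fin m) :
    sparseValue e ≤ sparseValue a ∨
      sparseValue a + (((m : ℝ) + 1) ^ (n + 1))⁻¹ ≤ sparseValue e := by
  rcases le_or_gt (e (PiNat.firstDiff e a)) (a (PiNat.firstDiff e a)) with h | h
  · exact .inl (sparseValue_le_of_firstDiff_le h)
  · have hlt : PiNat.firstDiff e a < n := by
      by_contra! hle
      exact (ha _ hle _).not_gt h
    rw [PiNat.firstDiff_comm] at h hlt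
    have hsep := inv_pow_firstDiff_le_sparseValue_sub h
    have hpow : (((m : ℝ) + 1) ^ (n + 1))⁻¹ ≤ (((m : ℝ) + 1) ^ (PiNat.firstDiff a e + 2))⁻¹ := by
      gcongr ?_⁻¹
      exact pow_le_pow_right₀ (by linarith [m.cast_nonneg (α := ℝ)]) (by omega)
    exact .inr (by linarith)

lemma rightPorous_sparseSet {m : ℕ} (hm : 0 < m) : RightPorous (sparseSet m) := by
  refine ⟨2 * (m + 1), by positivity, ?_⟩
  rintro _ ⟨d, rfl⟩ δ hδ
  have hbase : ((m : ℝ) + 1)⁻¹ < 1 := inv_lt_one_of_one_lt₀ (by simpa using hm)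
  obtain ⟨n, hn⟩ := exists_pow_lt_of_lt_one (half_pos hδ) hbase
  -- The last point of the set among those whose first `n` digits are those of `d`.
  let last : Fin m := ⟨m - 1, by omega⟩
  have hlast (i : Fin m) : i ≤ last := Fin.le_def.2 (Nat.le_sub_one_of_lt i.2)
  let a : ℕ → Fin m := fun k => if k < n then d k else last
  have ha_lt (k : ℕ) (hk : k < n) : a k = d k := if_pos hk
  have ha_ge (k : ℕ) (hk : n ≤ k) (i : Fin m) : i ≤ a k := by
    simpa only [a, if_neg hk.not_gt] using hlast i
  have hle : sparseValue d ≤ sparseValue a := by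
    refine sparseValue_le_of_firstDiff_le ?_
    rcases lt_or_ge (PiNat.firstDiff d a) n with h | h
    · exact (ha_lt _ h).ge
    · exact ha_ge _ h _
  have hclose : sparseValue a - sparseValue d ≤ (((m : ℝ) + 1) ^ n)⁻¹ := by
    have := Real.abs_ofDigits_sub_ofDigits_le (x := fun k => (a k).castSucc)
      (y := fun k => (d k).castSucc) (n := n) fun k hk => by rw [ha_lt k hk]
    exact_mod_cast (le_abs_self _).trans this
  have hscale : (((m : ℝ) + 1) ^ n)⁻¹ = (m + 1) * (((m : ℝ) + 1) ^ (n + 1))⁻¹ := by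
    field_simp
    ring
  have hpos : 0 < (((m : ℝ) + 1) ^ (n + 1))⁻¹ := by positivity
  rw [inv_pow] at hn
  refine ⟨sparseValue a, mem_range_self a, (((m : ℝ) + 1) ^ (n + 1))⁻¹ / 2, by positivity, hle,
    by nlinarith, by linarith, ?_⟩
  rintro _ ⟨e, rfl⟩
  rw [mul_div_cancel₀ _ two_ne_zero]
  exact sparseValue_gap ha_ge e

/-- `A` admits an `e`-Hölder map whose image covers the unit interval. This is a convenient
witness for lower bounds on Hausdorff dimensions, including those of products. -/
def HolderFills {X : Type*} [PseudoEMetricSpace X] (e : NNReal) (A : Set X) : Prop :=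
  ∃ (f : X → ℝ) (c : NNReal), HolderOnWith c e f A ∧ Icc 0 1 ⊆ f '' A

namespace HolderFills

variable {X : Type*} [EMetricSpace X] {e : NNReal} {A : Set X}

lemma le_dimH (h : HolderFills e A) (he : 0 < e) : (e : ENNReal) ≤ dimH A := by
  obtain ⟨f, c, hf, hsurj⟩ := h
  have hunit : dimH (Icc (0 : ℝ) 1) = 1 :=
    (Real.dimH_of_nonempty_interior (by simp)).trans (by simp)
  have hdim : 1 ≤ dimH A / e := hunit ▸ (dimH_mono hsurj).trans (hf.dimH_image_le he)
  rwa [ENNReal.le_div_iff_mul_le (by simp [he.ne']) (by simp), one_mul] at hdim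

lemma two_mul_le_dimH_prod_Ioi (h : HolderFills e A) (he : 0 < e) (he1 : e ≤ 1) :
    2 * (e : ENNReal) ≤ dimH (A ×ˢ Ioi (0 : ℝ)) := by
  obtain ⟨f, c, hf, hsurj⟩ := h
  have hid : HolderOnWith (1 * 1 ^ ((1 : NNReal) - e : ℝ)) e id (Ioc (0 : ℝ) 1) := by
    refine HolderOnWith.of_le (r := 1) (fun s hs t ht => ?_)
      LipschitzWith.id.lipschitzOnWith.holderOnWith he1
    rw [edist_le_coe, ← NNReal.coe_le_coe, coe_nndist, Real.dist_eq, abs_le]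
    constructor <;> simp only [NNReal.coe_one] <;> linarith [hs.1, hs.2, ht.1, ht.2]
  simp only [one_mul, NNReal.one_rpow] at hid
  have hprod : HolderOnWith (max c 1) e (Prod.map f id) (A ×ˢ Ioc (0 : ℝ) 1) := by
    intro p hp q hq
    rw [Prod.edist_eq]
    refine max_le ((hf.mono_const (le_max_left c 1) _ hp.1 _ hq.1).trans ?_)
      ((hid.mono_const (le_max_right c 1) _ hp.2 _ hq.2).trans ?_) <;> gcongr
    · exact le_max_left _ _
    · exact le_max_right _ _
  have hsquare : Icc (0 : ℝ) 1 ×ˢ Ioc (0 : ℝ) 1 ⊆ Prod.map f id '' A ×ˢ Ioc (0 : ℝ) 1 := by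
    rw [prodMap_image_prod, image_id]
    exact prod_mono hsurj Subset.rfl
  have hdim_square : dimH (Icc (0 : ℝ) 1 ×ˢ Ioc (0 : ℝ) 1) = 2 := by
    have hnhds : Icc (0 : ℝ) 1 ×ˢ Ioc (0 : ℝ) 1 ∈ 𝓝 ((1 / 2, 1 / 2) : ℝ × ℝ) :=
      prod_mem_nhds (Icc_mem_nhds (by norm_num) (by norm_num))
        (Ioc_mem_nhds (by norm_num) (by norm_num))
    simpa using Real.dimH_of_mem_nhds hnhds
  have hdim : 2 ≤ dimH (A ×ˢ Ioc (0 : ℝ) 1) / e :=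
    hdim_square ▸ (dimH_mono hsquare).trans (hprod.dimH_image_le he)
  rw [ENNReal.le_div_iff_mul_le (by simp [he.ne']) (by simp)] at hdim
  exact hdim.trans (dimH_mono (prod_mono_right Ioc_subset_Ioi_self))

end HolderFills

/-- The exponent `log m / log (m + 1)`, which is the similarity dimension of `sparseSet m`. -/
noncomputable def sparseExponent (m : ℕ) : NNReal :=
  (Real.log m / Real.log (m + 1)).toNNReal

lemma coe_sparseExponent (m : ℕ) :
    (sparseExponent m : ℝ) = Real.log m / Real.log (m + 1) :=
  Real.coe_toNNReal _ (div_nonneg (Real.log_natCast_nonneg m)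
    (Real.log_nonneg (by linarith [m.cast_nonneg (α := ℝ)])))

lemma sparseExponent_pos {m : ℕ} (hm : 2 ≤ m) : 0 < sparseExponent m := by
  have hm' : (1 : ℝ) < m := by exact_mod_cast hm
  exact Real.toNNReal_pos.2 (div_pos (Real.log_pos hm') (Real.log_pos (by linarith)))

lemma sparseExponent_le_one {m : ℕ} (hm : 0 < m) : sparseExponent m ≤ 1 := by
  have hm' : (0 : ℝ) < m := by exact_mod_cast hm
  rw [← NNReal.coe_le_coe, coe_sparseExponent, NNReal.coe_one]
  exact div_le_one_of_le₀ (Real.log_le_log hm' (by linarith)) (Real.log_nonneg (by linarith))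

lemma tendsto_sparseExponent : Tendsto sparseExponent atTop (𝓝 1) := by
  have hlog : Tendsto (fun m : ℕ => Real.log (m + 1)) atTop atTop :=
    Real.tendsto_log_atTop.comp
      (tendsto_atTop_add_const_right _ 1 (tendsto_natCast_atTop_atTop (R := ℝ)))
  have h := (tendsto_const_nhds (x := (1 : ℝ))).sub
    (Real.tendsto_log_nat_add_one_sub_log.div_atTop hlog)
  rw [sub_zero] at h
  rw [← NNReal.tendsto_coe, NNReal.coe_one]
  refine h.congr' ?_
  filter_upwards [hlog.eventually_gt_atTop 0] with m hm
  rw [coe_sparseExponent, eq_div_iff hm.ne', sub_mul, div_mul_cancel₀ _ hm.ne']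
  ring

lemma inv_pow_rpow_sparseExponent {m : ℕ} (hm : 0 < m) (n : ℕ) :
    ((((m : ℝ) + 1) ^ n)⁻¹) ^ (sparseExponent m : ℝ) = ((m : ℝ) ^ n)⁻¹ := by
  have hm' : (0 : ℝ) < m := by exact_mod_cast hm
  have hbase : ((m : ℝ) + 1) ^ (sparseExponent m : ℝ) = m := by
    rw [coe_sparseExponent, Real.rpow_def_of_pos (by linarith),
      mul_div_cancel₀ _ (Real.log_pos (by linarith)).ne', Real.exp_log hm']
  rw [Real.inv_rpow (by positivity), ← Real.rpow_natCast, ← Real.rpow_mul (by positivity), mul_comm,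
    Real.rpow_mul (by positivity), hbase, Real.rpow_natCast]

lemma abs_ofDigits_sub_le_sparseValue {m : ℕ} (d e : ℕ → Fin m) :
    |Real.ofDigits d - Real.ofDigits e| ≤
      m ^ 2 * |sparseValue d - sparseValue e| ^ (sparseExponent m : ℝ) := by
  rcases eq_or_ne d e with rfl | hne
  · simp only [sub_self, abs_zero]
    positivity
  set n := PiNat.firstDiff d e
  have hm : 0 < m := Fin.pos (d 0)
  calc |Real.ofDigits d - Real.ofDigits e| ≤ ((m : ℝ) ^ n)⁻¹ :=
        Real.abs_ofDigits_sub_ofDigits_le fun i hi => PiNat.apply_eq_of_lt_firstDiff hi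
    _ = m ^ 2 * ((((m : ℝ) + 1) ^ (n + 2))⁻¹) ^ (sparseExponent m : ℝ) := by
        have : (m : ℝ) ≠ 0 := by positivity
        rw [inv_pow_rpow_sparseExponent hm, pow_add]
        field_simp
    _ ≤ m ^ 2 * |sparseValue d - sparseValue e| ^ (sparseExponent m : ℝ) := by
        gcongr
        exact inv_pow_firstDiff_le_abs_sparseValue_sub hne

/-- Reading the digits of a point of `sparseSet m` in base `m` instead of `m + 1` is a Hölder map
onto `[0, 1]`. -/
lemma holderFills_sparseSet {m : ℕ} (hm : 2 ≤ m) :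
    HolderFills (sparseExponent m) (sparseSet m) := by
  have : Nonempty (ℕ → Fin m) := ⟨fun _ => ⟨0, by omega⟩⟩
  let digits : ℝ → ℕ → Fin m := Function.invFun sparseValue
  have hdigits : ∀ d : ℕ → Fin m, digits (sparseValue d) = d :=
    Function.leftInverse_invFun sparseValue_injective
  refine ⟨fun x => Real.ofDigits (digits x), m ^ 2, ?_, fun z hz => ?_⟩
  · rintro _ ⟨d, rfl⟩ _ ⟨e, rfl⟩
    simp only [hdigits]
    rw [edist_dist, edist_dist, Real.dist_eq, Real.dist_eq,
      ENNReal.ofReal_rpow_of_nonneg (abs_nonneg _) (sparseExponent m).coe_nonneg,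
      ← ENNReal.ofReal_coe_nnreal, ← ENNReal.ofReal_mul (NNReal.coe_nonneg _)]
    exact ENNReal.ofReal_le_ofReal (by simpa using abs_ofDigits_sub_le_sparseValue d e)
  · obtain ⟨d, -, hd⟩ := Real.ofDigits_SurjOn (b := m) hm hz
    exact ⟨sparseValue d, mem_range_self d, by simp only [hdigits, hd]⟩

/-- A density with values in `[0, 1]` whose mean values over the intervals `[0, t]` oscillate as
`t` tends to `0`. -/
noncomputable def oscDensity (s : ℝ) : ℝ := 1 / 2 + Real.sin (Real.log s) / 2

lemma oscDensity_mem_Icc (s : ℝ) : oscDensity s ∈ Icc 0 1 := by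
  have hlower := Real.neg_one_le_sin (Real.log s)
  have hupper := Real.sin_le_one (Real.log s)
  constructor <;> unfold oscDensity <;> linarith

@[fun_prop]
lemma measurable_oscDensity : Measurable oscDensity := by
  unfold oscDensity
  fun_prop

lemma continuousAt_oscDensity {s : ℝ} (hs : s ≠ 0) : ContinuousAt oscDensity s := by
  unfold oscDensity
  have := Real.continuousAt_log hs
  fun_prop

lemma intervalIntegrable_oscDensity_comp {u : ℝ → ℝ} (hu : Measurable u) (a b : ℝ) :
    IntervalIntegrable (fun t => oscDensity (u t)) volume a b :=
  (intervalIntegrable_const (c := (1 : ℝ))).mono_fun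
    (measurable_oscDensity.comp hu).aestronglyMeasurable <| .of_forall fun t => by
      simpa [abs_of_nonneg (oscDensity_mem_Icc (u t)).1] using (oscDensity_mem_Icc (u t)).2

lemma continuous_mul_comp_log {f : ℝ → ℝ} (hf : Continuous f) {c : ℝ} (hc : ∀ x, |f x| ≤ c) :
    Continuous fun s => s * f (Real.log s) := by
  refine continuous_iff_continuousAt.2 fun s => ?_
  rcases eq_or_ne s 0 with rfl | hs
  · have hbound (s : ℝ) : ‖s * f (Real.log s)‖ ≤ |s| * c := by
      rw [Real.norm_eq_abs, abs_mul]
      exact mul_le_mul_of_nonneg_left (hc _) (abs_nonneg s)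
    have hzero : Tendsto (fun s : ℝ => |s| * c) (𝓝 0) (𝓝 0) := by
      simpa using (continuous_abs.tendsto (0 : ℝ)).mul_const c
    simpa [ContinuousAt] using squeeze_zero_norm hbound hzero
  · exact continuousAt_id.mul (hf.continuousAt.comp (Real.continuousAt_log hs))

lemma integral_oscDensity {t : ℝ} (ht : 0 ≤ t) :
    ∫ s in (0 : ℝ)..t, oscDensity s =
      (1 / 2 + (Real.sin (Real.log t) - Real.cos (Real.log t)) / 4) * t := by
  let P : ℝ → ℝ := fun t =>
    t / 2 + (t * Real.sin (Real.log t) - t * Real.cos (Real.log t)) / 4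
  have hcont : Continuous P :=
    (continuous_id.div_const 2).add
      (((continuous_mul_comp_log Real.continuous_sin Real.abs_sin_le_one).sub
        (continuous_mul_comp_log Real.continuous_cos Real.abs_cos_le_one)).div_const 4)
  have hderiv (s : ℝ) (hs : s ∈ Ioo 0 t) : HasDerivAt P (oscDensity s) s := by
    have hs0 : s ≠ 0 := hs.1.ne'
    have hlog := Real.hasDerivAt_log hs0
    refine (((hasDerivAt_id s).div_const 2).add ((((hasDerivAt_id s).mul hlog.sin).sub
      ((hasDerivAt_id s).mul hlog.cos)).div_const 4)).congr_deriv ?_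
    simp only [oscDensity, id]
    field_simp
    ring
  rw [intervalIntegral.integral_eq_sub_of_hasDerivAt_of_le ht hcont.continuousOn hderiv
    (intervalIntegrable_oscDensity_comp measurable_id 0 t)]
  simp only [P]
  ring

/-- The primitive of the oscillating density of the distance to `C`: it fails to be differentiable
at the points of `C` when `C` has large gaps next to them. -/
noncomputable def oscPrimitive (C : Set ℝ) (x : ℝ) : ℝ :=
  ∫ t in (0 : ℝ)..x, oscDensity (infDist t C)

section oscPrimitive

variable {C : Set ℝ} {x y : ℝ}

lemma oscPrimitive_sub (C : Set ℝ) (x y : ℝ) :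
    oscPrimitive C y - oscPrimitive C x = ∫ t in x..y, oscDensity (infDist t C) :=
  have hint := intervalIntegrable_oscDensity_comp (continuous_infDist_pt C).measurable
  intervalIntegral.integral_interval_sub_left (hint _ _) (hint _ _)

lemma oscPrimitive_sub_mem_Icc (hxy : x ≤ y) :
    oscPrimitive C y - oscPrimitive C x ∈ Icc 0 (y - x) := by
  rw [oscPrimitive_sub]
  refine ⟨intervalIntegral.integral_nonneg hxy fun t _ => (oscDensity_mem_Icc _).1, ?_⟩
  calc ∫ t in x..y, oscDensity (infDist t C) ≤ ∫ _ in x..y, (1 : ℝ) :=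
        intervalIntegral.integral_mono_on hxy
          (intervalIntegrable_oscDensity_comp (continuous_infDist_pt C).measurable _ _)
          intervalIntegrable_const fun t _ => (oscDensity_mem_Icc _).2
    _ = y - x := by simp

lemma abs_oscPrimitive_le (C : Set ℝ) (x : ℝ) : |oscPrimitive C x| ≤ |x| := by
  have hbound (t : ℝ) : ‖oscDensity (infDist t C)‖ ≤ 1 := by
    rw [Real.norm_eq_abs, abs_of_nonneg (oscDensity_mem_Icc _).1]
    exact (oscDensity_mem_Icc _).2
  simpa [oscPrimitive] using
    intervalIntegral.norm_integral_le_of_norm_le_const (a := 0) (b := x) fun t _ => hbound t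

lemma differentiableAt_oscPrimitive (hC : IsClosed C) (hne : C.Nonempty) (hx : x ∉ C) :
    DifferentiableAt ℝ (oscPrimitive C) x := by
  have hdist := continuous_infDist_pt C
  have hpos : infDist x C ≠ 0 := ((hC.notMem_iff_infDist_pos hne).1 hx).ne'
  exact (intervalIntegral.integral_hasDerivAt_right
    (intervalIntegrable_oscDensity_comp hdist.measurable _ _)
    (measurable_oscDensity.comp hdist.measurable).stronglyMeasurable.stronglyMeasurableAtFilter
    (ContinuousAt.comp (f := fun t => infDist t C) (continuousAt_oscDensity hpos)
      hdist.continuousAt)).differentiableAt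

lemma infDist_add_of_gap {a h t : ℝ} (ha : a ∈ C) (hgap : ∀ y ∈ C, y ≤ a ∨ a + 2 * h ≤ y)
    (ht : t ∈ Icc 0 h) : infDist (a + t) C = t := by
  obtain ⟨ht0, hth⟩ := ht
  refine le_antisymm ?_ ((le_infDist ⟨a, ha⟩).2 fun y hy => ?_)
  · simpa [abs_of_nonneg ht0] using infDist_le_dist_of_mem (x := a + t) ha
  · rw [Real.dist_eq]
    rcases hgap y hy with hya | hya
    · exact le_trans (by linarith) (le_abs_self _)
    · exact le_trans (by linarith) (neg_le_abs _)

lemma oscPrimitive_sub_of_gap {a h t : ℝ} (ha : a ∈ C)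
    (hgap : ∀ y ∈ C, y ≤ a ∨ a + 2 * h ≤ y) (ht : t ∈ Icc 0 h) :
    oscPrimitive C (a + t) - oscPrimitive C a =
      (1 / 2 + (Real.sin (Real.log t) - Real.cos (Real.log t)) / 4) * t := by
  rw [← integral_oscDensity ht.1, oscPrimitive_sub]
  calc ∫ s in a..(a + t), oscDensity (infDist s C)
      = ∫ s in (0 : ℝ)..t, oscDensity (infDist (a + s) C) := by
        rw [intervalIntegral.integral_comp_add_left (fun s => oscDensity (infDist s C)), add_zero]
    _ = ∫ s in (0 : ℝ)..t, oscDensity s := intervalIntegral.integral_congr fun s hs => by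
        rw [uIcc_of_le ht.1] at hs
        simp only [infDist_add_of_gap ha hgap ⟨hs.1, hs.2.trans ht.2⟩]

end oscPrimitive

lemma exists_log_eq_mod_two_pi (θ : ℝ) {h : ℝ} (hh : 0 < h) :
    ∃ t ∈ Icc (Real.exp (-(2 * Real.pi)) * h) h,
      Real.sin (Real.log t) = Real.sin θ ∧ Real.cos (Real.log t) = Real.cos θ := by
  obtain ⟨hlower, hupper⟩ :=
    toIocMod_mem_Ioc Real.two_pi_pos (Real.log h - 2 * Real.pi) θ
  refine ⟨Real.exp (toIocMod Real.two_pi_pos (Real.log h - 2 * Real.pi) θ), ⟨?_, ?_⟩, ?_, ?_⟩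
  · rw [← Real.exp_log hh, ← Real.exp_add, Real.log_exp]
    exact Real.exp_le_exp.2 (by linarith)
  · rw [← Real.le_log_iff_exp_le hh]
    linarith
  · rw [Real.log_exp, toIocMod, zsmul_eq_mul, Real.sin_sub_int_mul_two_pi]
  · rw [Real.log_exp, toIocMod, zsmul_eq_mul, Real.cos_sub_int_mul_two_pi]

namespace RightPorous

variable {C : Set ℝ} {x : ℝ}

/-- The gaps of `C` close to `x` are at a distance comparable to their length, so the
differentiability of `H` at `x` controls its increments at the scale of the gap. -/
lemma exists_gap_linear_approx (hC : RightPorous C) (hx : x ∈ C) {H : ℝ → ℝ} {D : ℝ}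
    (hH : HasDerivWithinAt H D (Ioi x) x) {c ε : ℝ} (hc : 0 < c) (hε : 0 < ε) :
    ∃ a ∈ C, ∃ h > 0, (∀ y ∈ C, y ≤ a ∨ a + 2 * h ≤ y) ∧
      ∀ t ∈ Icc (c * h) h, |H (a + t) - H a - D * t| ≤ ε * t := by
  obtain ⟨M, hM, hgaps⟩ := hC
  set η := ε * c / (2 * (M + 1)) with hη
  have hη0 : 0 < η := by positivity
  have happrox := (hasDerivWithinAt_iff_isLittleO.1 hH.Ici_of_Ioi).def hη0
  rw [eventually_nhdsWithin_iff, Metric.eventually_nhds_iff_ball] at happrox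
  obtain ⟨δ, hδ, happrox⟩ := happrox
  obtain ⟨a, ha, h, hh, hxa, hahδ, haM, hgap⟩ := hgaps x hx (δ / 2) (by positivity)
  refine ⟨a, ha, h, hh, hgap, fun t ⟨hct, hth⟩ => ?_⟩
  have ht : 0 < t := (by positivity : 0 < c * h).trans_le hct
  have hincr (z : ℝ) (hz : z ∈ Icc a (a + h)) : |H z - H x - D * (z - x)| ≤ ε / 2 * t := by
    have hzx : 0 ≤ z - x := by linarith [hz.1]
    have hball : z ∈ ball x δ := by
      rw [mem_ball, Real.dist_eq, abs_of_nonneg hzx]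
      linarith [hz.2]
    have hle := happrox z hball (hxa.trans hz.1)
    rw [Real.norm_eq_abs, Real.norm_eq_abs, abs_of_nonneg hzx, smul_eq_mul, mul_comm _ D] at hle
    calc |H z - H x - D * (z - x)| ≤ η * (z - x) := hle
      _ ≤ η * ((M + 1) * h) := by gcongr; linarith [hz.2]
      _ = ε / 2 * (c * h) := by rw [hη]; field_simp
      _ ≤ ε / 2 * t := by gcongr
  have hstart := abs_le.1 (hincr a ⟨le_rfl, by linarith⟩)
  have hend := abs_le.1 (hincr (a + t) ⟨by linarith, by linarith⟩)
  rw [abs_le]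
  constructor <;> linarith [hstart.1, hstart.2, hend.1, hend.2]

/-- In a gap of `C`, the mean slope of `oscPrimitive C` is `1 / 4` at some scales and `3 / 4` at
others; this is too much of an oscillation to be compensated by the slopes of `R`. -/
lemma not_differentiableWithinAt_oscPrimitive_add (hC : RightPorous C) (hx : x ∈ C) {w : ℝ}
    (hw : 0 < w) {R : ℝ → ℝ} (hR : ∀ p q, p ≤ q → R q - R p ∈ Icc 0 (w / 3 * (q - p))) :
    ¬ DifferentiableWithinAt ℝ (fun y => w * oscPrimitive C y + R y) (Ioi x) x := by
  intro hdiff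
  obtain ⟨a, ha, h, hh, hgap, happrox⟩ := hC.exists_gap_linear_approx hx
    hdiff.hasDerivWithinAt (Real.exp_pos (-(2 * Real.pi))) (show 0 < w / 24 by positivity)
  set D := derivWithin (fun y => w * oscPrimitive C y + R y) (Ioi x) x
  have hslope (θ : ℝ) : ∃ r ∈ Icc 0 (w / 3),
      |w * (1 / 2 + (Real.sin θ - Real.cos θ) / 4) + r - D| ≤ w / 24 := by
    obtain ⟨t, ht, hsin, hcos⟩ := exists_log_eq_mod_two_pi θ hh
    have ht0 : 0 < t := (mul_pos (Real.exp_pos _) hh).trans_le ht.1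
    have hRt := hR a (a + t) (by linarith)
    rw [add_sub_cancel_left] at hRt
    have hosc := oscPrimitive_sub_of_gap ha hgap ⟨ht0.le, ht.2⟩
    rw [hsin, hcos] at hosc
    refine ⟨(R (a + t) - R a) / t, ⟨div_nonneg hRt.1 ht0.le, (div_le_iff₀ ht0).2 hRt.2⟩, ?_⟩
    refine le_of_mul_le_mul_right ?_ ht0
    rw [← abs_of_pos ht0, ← abs_mul, abs_of_pos ht0]
    refine le_of_eq_of_le (congrArg abs ?_) (happrox t ht)
    rw [sub_mul, add_mul, div_mul_cancel₀ _ ht0.ne']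
    linear_combination -w * hosc
  obtain ⟨r, hr, hsmall⟩ := hslope 0
  obtain ⟨r', hr', hlarge⟩ := hslope Real.pi
  simp only [Real.sin_zero, Real.cos_zero, Real.sin_pi, Real.cos_pi] at hsmall hlarge
  linarith [(abs_le.1 hsmall).1, (abs_le.1 hlarge).2, hr.2, hr'.1]

end RightPorous

/-- The points where `F` does not have a finite right derivative. -/
def rightSingularSet (F : ℝ → ℝ) : Set ℝ := {x | ¬ DifferentiableWithinAt ℝ F (Ioi x) x}

/-- The superposition of the oscillating primitives of a sequence of sets. The ratio `1 / 4` of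
consecutive weights makes the oscillation of each term dominate the sum of all later ones. -/
noncomputable def oscSum (C : ℕ → Set ℝ) (x : ℝ) : ℝ :=
  ∑' k, (1 / 4 : ℝ) ^ k * oscPrimitive (C k) x

lemma summable_oscSum (C : ℕ → Set ℝ) (x : ℝ) :
    Summable fun k => (1 / 4 : ℝ) ^ k * oscPrimitive (C k) x := by
  refine Summable.of_norm_bounded (g := fun k => (1 / 4 : ℝ) ^ k * |x|)
    ((summable_geometric_of_lt_one (by norm_num) (by norm_num)).mul_right _) fun k => ?_
  rw [norm_mul, Real.norm_eq_abs, Real.norm_eq_abs, abs_of_nonneg (by positivity)]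
  exact mul_le_mul_of_nonneg_left (abs_oscPrimitive_le _ _) (by positivity)

lemma oscSum_sub_mem_Icc (C : ℕ → Set ℝ) {x y : ℝ} (hxy : x ≤ y) :
    oscSum C y - oscSum C x ∈ Icc 0 (4 / 3 * (y - x)) := by
  have hsum := (summable_oscSum C y).hasSum.sub (summable_oscSum C x).hasSum
  simp only [← mul_sub] at hsum
  have hgeom : HasSum (fun k : ℕ => (1 / 4 : ℝ) ^ k * (y - x)) (4 / 3 * (y - x)) := by
    convert! (hasSum_geometric_of_lt_one (r := (1 / 4 : ℝ)) (by norm_num) (by norm_num)).mul_right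
      (y - x) using 2
    norm_num
  have hterm (k : ℕ) := oscPrimitive_sub_mem_Icc (C := C k) hxy
  exact ⟨hsum.nonneg fun k => mul_nonneg (by positivity) (hterm k).1,
    hasSum_le (fun k => mul_le_mul_of_nonneg_left (hterm k).2 (by positivity)) hsum hgeom⟩

lemma monotone_oscSum (C : ℕ → Set ℝ) : Monotone (oscSum C) :=
  fun _ _ hxy => sub_nonneg.1 (oscSum_sub_mem_Icc C hxy).1

lemma lipschitzWith_oscSum (C : ℕ → Set ℝ) : LipschitzWith (4 / 3) (oscSum C) := by
  refine LipschitzWith.of_le_add_mul _ fun x y => ?_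
  rw [Real.dist_eq, NNReal.coe_div, NNReal.coe_ofNat, NNReal.coe_ofNat]
  rcases le_total x y with h | h
  · linarith [monotone_oscSum C h, abs_nonneg (x - y)]
  · linarith [(oscSum_sub_mem_Icc C h).2, le_abs_self (x - y)]

lemma oscSum_eq_sum_range_add (C : ℕ → Set ℝ) (i : ℕ) (x : ℝ) :
    oscSum C x = (∑ k ∈ Finset.range i, (1 / 4 : ℝ) ^ k * oscPrimitive (C k) x) +
      ((1 / 4 : ℝ) ^ i * oscPrimitive (C i) x +
        (1 / 4 : ℝ) ^ (i + 1) * oscSum (fun k => C (k + (i + 1))) x) := by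
  rw [oscSum, ← Summable.sum_add_tsum_nat_add (i + 1) (summable_oscSum C x),
    Finset.sum_range_succ, add_assoc, oscSum, ← tsum_mul_left]
  congr 2
  exact tsum_congr fun k => by ring

theorem iUnion_subset_rightSingularSet_oscSum {C : ℕ → Set ℝ} (hcl : ∀ i, IsClosed (C i))
    (hne : ∀ i, (C i).Nonempty) (hC : ∀ i, RightPorous (C i)) :
    ⋃ i, C i ⊆ rightSingularSet (oscSum C) := by
  classical
  intro x hx hdiff
  rw [mem_iUnion] at hx
  -- At `x`, the terms before the first set containing `x` are differentiable.
  set i := Nat.find hx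
  have hearlier : DifferentiableAt ℝ
      (fun y => ∑ k ∈ Finset.range i, (1 / 4 : ℝ) ^ k * oscPrimitive (C k) y) x :=
    DifferentiableAt.fun_sum fun k hk => (differentiableAt_oscPrimitive (hcl k) (hne k)
      (Nat.find_min hx (Finset.mem_range.1 hk))).const_mul _
  refine (hC i).not_differentiableWithinAt_oscPrimitive_add (Nat.find_spec hx)
    (w := (1 / 4) ^ i) (by positivity) (R := fun y =>
      (1 / 4 : ℝ) ^ (i + 1) * oscSum (fun k => C (k + (i + 1))) y) (fun p q hpq => ?_) ?_
  · have hlater := oscSum_sub_mem_Icc (fun k => C (k + (i + 1))) hpq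
    rw [← mul_sub]
    refine ⟨mul_nonneg (by positivity) hlater.1, ?_⟩
    calc _ ≤ (1 / 4 : ℝ) ^ (i + 1) * (4 / 3 * (q - p)) := by gcongr; exact hlater.2
      _ = (1 / 4 : ℝ) ^ i / 3 * (q - p) := by ring
  · refine (hdiff.sub hearlier.differentiableWithinAt).congr (fun y _ => ?_) ?_ <;>
    · rw [Pi.sub_apply, oscSum_eq_sum_range_add C i, add_sub_cancel_left]

theorem exists_monotone_lipschitzWith_rightSingularSet :
    ∃ F : ℝ → ℝ, Monotone F ∧ (∃ L, LipschitzWith L F) ∧ Dense (rightSingularSet F) ∧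
      1 ≤ dimH (rightSingularSet F) ∧ 2 ≤ dimH (rightSingularSet F ×ˢ Ioi (0 : ℝ)) := by
  obtain ⟨enum, henum⟩ := exists_surjective_nat (ℚ × ℕ)
  let C : ℕ → Set ℝ := fun i => (· - ((enum i).1 : ℝ)) ⁻¹' sparseSet ((enum i).2 + 1)
  have hsubset (q : ℚ) {m : ℕ} (hm : 0 < m) :
      (· - (q : ℝ)) ⁻¹' sparseSet m ⊆ rightSingularSet (oscSum C) := by
    obtain ⟨i, hi⟩ := henum (q, m - 1)
    have hCi : C i = (· - (q : ℝ)) ⁻¹' sparseSet m := by simp only [C, hi, Nat.sub_add_cancel hm]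
    refine hCi ▸ (subset_iUnion C i).trans (iUnion_subset_rightSingularSet_oscSum ?_ ?_ ?_)
    · exact fun i => (isClosed_sparseSet _).preimage (continuous_sub_right _)
    · exact fun i => ⟨(enum i).1, by simpa [C] using zero_mem_sparseSet (Nat.succ_pos _)⟩
    · exact fun i => (rightPorous_sparseSet (Nat.succ_pos _)).preimage_sub_const _
  have hsparse {m : ℕ} (hm : 0 < m) : sparseSet m ⊆ rightSingularSet (oscSum C) := by
    simpa using hsubset 0 hm
  have hexp : Tendsto (fun m => (sparseExponent m : ENNReal)) atTop (𝓝 1) :=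
    ENNReal.tendsto_coe.2 tendsto_sparseExponent
  refine ⟨oscSum C, monotone_oscSum C, ⟨_, lipschitzWith_oscSum C⟩, ?_, ?_, ?_⟩
  · refine Rat.denseRange_cast.mono (range_subset_iff.2 fun q => hsubset q one_pos ?_)
    simpa using zero_mem_sparseSet one_pos
  · refine le_of_tendsto hexp ?_
    filter_upwards [eventually_ge_atTop 2] with m hm
    exact ((holderFills_sparseSet hm).le_dimH (sparseExponent_pos hm)).trans
      (dimH_mono (hsparse (by omega)))
  · refine le_of_tendsto (by simpa using ENNReal.Tendsto.const_mul hexp (.inr (by simp))) ?_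
    filter_upwards [eventually_ge_atTop 2] with m hm
    exact ((holderFills_sparseSet hm).two_mul_le_dimH_prod_Ioi (sparseExponent_pos hm)
      (sparseExponent_le_one (by omega))).trans (dimH_mono (prod_mono_left (hsparse (by omega))))

section Multivalued

variable {E F : Type*} [NormedAddCommGroup E] [NormedSpace ℝ E]
  [NormedAddCommGroup F] [NormedSpace ℝ F]

lemma multiDirDifferentiableAt_iff_of_eq_singleton {T : E → Set F} {ξ : E → F}
    (hT : ∀ y, T y = {ξ y}) {x : E} :
    MultiDirDifferentiableAt T x ↔
      ∀ v, DifferentiableWithinAt ℝ (fun t : ℝ => ξ (x + t • v)) (Ioi 0) 0 := by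
  have hline (v : E) (w : F) :
      HasDerivWithinAt (fun t : ℝ => ξ (x + t • v)) w (Ioi 0) 0 ↔
        ∀ ε > 0, ∃ δ > 0, ∀ t : ℝ, 0 < t → t ≤ δ → ‖ξ (x + t • v) - ξ x - t • w‖ ≤ ε * t := by
    rw [hasDerivWithinAt_iff_isLittleO, isLittleO_iff]
    refine forall₂_congr fun ε _ => ?_
    rw [nhdsGT_basis_Ioc (0 : ℝ) |>.eventually_iff]
    refine exists_congr fun δ => and_congr_right fun _ => ?_
    simp only [mem_Ioc, and_imp, zero_smul, add_zero, sub_zero, Real.norm_eq_abs]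
    refine forall₂_congr fun t ht => ?_
    rw [abs_of_pos ht]
  simp only [MultiDirDifferentiableAt, hT, singleton_eq_singleton_iff, exists_eq_left',
    mem_singleton_iff, forall_eq, ← hline]
  exact forall_congr' fun v => ⟨fun ⟨w, hw⟩ => hw.differentiableWithinAt,
    fun h => ⟨_, h.hasDerivWithinAt⟩⟩

end Multivalued

section SecondOrder

variable {E : Type*} [NormedAddCommGroup E] [NormedSpace ℝ E]

lemma hasFDerivAt_of_secondOrder {f : E → ℝ} {x : E} {L : E →L[ℝ] ℝ} {B : E →L[ℝ] E →L[ℝ] ℝ}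
    (hf : (fun y => f y - (f x + L (y - x) + B (y - x) (y - x))) =o[𝓝 x] fun y => ‖y - x‖ ^ 2) :
    HasFDerivAt f L x := by
  have hsq : (fun y => ‖y - x‖ ^ 2) =o[𝓝 x] fun y => y - x := isLittleO_pow_sub_sub x one_lt_two
  have hB : (fun y => B (y - x) (y - x)) =O[𝓝 x] fun y => ‖y - x‖ ^ 2 :=
    .of_bound ‖B‖ <| .of_forall fun y => by
      simpa [pow_two, mul_assoc] using B.le_opNorm₂ (y - x) (y - x)
  rw [hasFDerivAt_iff_isLittleO]
  exact ((hf.trans hsq).add (hB.trans_isLittleO hsq)).congr_left fun y => by ring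

lemma PointwiseTwiceDifferentiableAt.sq_div_two {f : E → ℝ} {x : E}
    (hf : PointwiseTwiceDifferentiableAt f x) :
    PointwiseTwiceDifferentiableAt (fun y => f y ^ 2 / 2) x := by
  obtain ⟨L, B, hB⟩ := hf
  refine ⟨f x • L, f x • B + (1 / 2 : ℝ) • L.smulRight L, ?_⟩
  have hfirst := (hasFDerivAt_of_secondOrder hB).isLittleO
  have hL : (fun y => L (y - x)) =O[𝓝 x] fun y => y - x := L.isBigO_sub _ _
  have hsum : (fun y => f y - f x + L (y - x)) =O[𝓝 x] fun y => ‖y - x‖ :=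
    ((hfirst.isBigO.add (hL.const_mul_left 2)).congr_left fun y => by ring).norm_right
  -- With `u = y - x` and `R` the remainder of `f`, the remainder of `f ^ 2 / 2` is
  -- `f x * R + (f y - f x - L u) * (f y - f x + L u) / 2`.
  refine ((hB.const_mul_left (f x)).add
    ((hfirst.norm_right.mul_isBigO hsum).const_mul_left (1 / 2) |>.congr_right fun y =>
      (sq _).symm)).congr_left fun y => ?_
  simp only [FunLike.coe_add, FunLike.coe_smul, Pi.add_apply, Pi.smul_apply, smul_eq_mul,
    ContinuousLinearMap.smulRight_apply]
  ring

lemma eq_of_isSubgradient_of_hasFDerivAt {φ : E → ℝ} {x : E} {p L : E →L[ℝ] ℝ}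
    (hp : ∀ z, p (z - x) ≤ φ z - φ x) (hφ : HasFDerivAt φ L x) : p = L := by
  have hmin : IsLocalMin (fun z => φ z - p z) x := .of_forall fun z => by
    have := hp z
    rw [map_sub] at this
    linarith
  exact (sub_eq_zero.1 (hmin.hasFDerivAt_eq_zero (hφ.sub p.hasFDerivAt))).symm

section Subgradient

variable {φ : E → ℝ} {p : E → E →L[ℝ] ℝ} {x : E} {L : E →L[ℝ] ℝ} {B : E →L[ℝ] E →L[ℝ] ℝ}

/-- Compare the subgradient inequality along segments of length `c * ‖y - x‖` starting at `y` with
the second-order expansion of `φ` at their endpoints. -/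
lemma eventually_subgradient_sub_apply_le (hp : ∀ y z, p y (z - y) ≤ φ z - φ y)
    (hφ : (fun y => φ y - (φ x + L (y - x) + B (y - x) (y - x))) =o[𝓝 x] fun y => ‖y - x‖ ^ 2)
    {c ε : ℝ} (hc : 0 < c) (hε : 0 < ε) :
    ∀ᶠ y in 𝓝 x, ∀ e, ‖e‖ = 1 →
      (p y - p x - (B + B.flip) (y - x)) e ≤ (c * ‖B‖ + ε) * ‖y - x‖ := by
  have hpx : p x = L := eq_of_isSubgradient_of_hasFDerivAt (hp x) (hasFDerivAt_of_secondOrder hφ)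
  set η := ε * c / (2 * (1 + c) ^ 2) with hη
  obtain ⟨δ, hδ, hR⟩ := Metric.eventually_nhds_iff_ball.1 (hφ.def (show 0 < η by positivity))
  filter_upwards [ball_mem_nhds x (show 0 < δ / (1 + c) by positivity)] with y hy e he
  rw [mem_ball, dist_eq_norm, lt_div_iff₀ (by positivity)] at hy
  rcases eq_or_ne y x with rfl | hyx
  · simp
  have hu : 0 < ‖y - x‖ := norm_sub_pos_iff.2 hyx
  set s := c * ‖y - x‖ with hs
  have hs0 : 0 < s := by positivity
  have hremainder (z : E) (hz : ‖z - x‖ ≤ (1 + c) * ‖y - x‖) :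
      |φ z - (φ x + L (z - x) + B (z - x) (z - x))| ≤ s * (ε / 2 * ‖y - x‖) := by
    have hle := hR z (by rw [mem_ball, dist_eq_norm]; linarith)
    rw [Real.norm_eq_abs, Real.norm_of_nonneg (sq_nonneg ‖z - x‖)] at hle
    calc _ ≤ η * ‖z - x‖ ^ 2 := hle
      _ ≤ η * ((1 + c) * ‖y - x‖) ^ 2 := by gcongr
      _ = s * (ε / 2 * ‖y - x‖) := by rw [hη, hs]; field_simp
  have hy_rem := abs_le.1 (hremainder y (by nlinarith))
  have hz_rem := abs_le.1 (hremainder (y + s • e) (by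
    rw [add_sub_right_comm]
    refine (norm_add_le _ _).trans_eq ?_
    rw [norm_smul, he, Real.norm_of_nonneg hs0.le]
    ring))
  have hBe : B e e ≤ ‖B‖ := by
    simpa [he] using (le_abs_self _).trans (B.le_opNorm₂ e e)
  have hsub : s * p y e ≤ φ (y + s • e) - φ y := by
    simpa using hp y (y + s • e)
  refine le_of_mul_le_mul_left ?_ hs0
  have hexpand : s * (c * ‖B‖ + ε) * ‖y - x‖ = s * (s * ‖B‖) + 2 * (s * (ε / 2 * ‖y - x‖)) := by
    rw [hs]; ring
  have hBs : s * (s * B e e) ≤ s * (s * ‖B‖) := by gcongr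
  simp only [add_sub_right_comm y, map_add, map_smul, FunLike.coe_add, FunLike.coe_sub,
    FunLike.coe_smul, Pi.add_apply, Pi.sub_apply, Pi.smul_apply, smul_eq_mul,
    ContinuousLinearMap.flip_apply, hpx] at hz_rem hy_rem ⊢
  linarith only [hz_rem.2, hy_rem.1, hexpand, hBs, hsub]

theorem hasFDerivAt_subgradient_of_secondOrder (hp : ∀ y z, p y (z - y) ≤ φ z - φ y)
    (hφ : (fun y => φ y - (φ x + L (y - x) + B (y - x) (y - x))) =o[𝓝 x]
      fun y => ‖y - x‖ ^ 2) :
    HasFDerivAt p (B + B.flip) x := by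
  rw [hasFDerivAt_iff_isLittleO, isLittleO_iff]
  intro ε hε
  have hc : ε / (2 * (‖B‖ + 1)) * ‖B‖ + ε / 2 ≤ ε := by
    have : ε / (2 * (‖B‖ + 1)) * ‖B‖ ≤ ε / (2 * (‖B‖ + 1)) * (‖B‖ + 1) := by gcongr; linarith
    have : ε / (2 * (‖B‖ + 1)) * (‖B‖ + 1) = ε / 2 := by field_simp
    linarith
  filter_upwards [eventually_subgradient_sub_apply_le hp hφ
    (show 0 < ε / (2 * (‖B‖ + 1)) by positivity) (half_pos hε)] with y hy
  have hle (e : E) (he : ‖e‖ = 1) :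
      (p y - p x - (B + B.flip) (y - x)) e ≤ ε * ‖y - x‖ :=
    (hy e he).trans (by gcongr)
  refine ContinuousLinearMap.opNorm_le_of_unit_norm (by positivity) fun e he => ?_
  have hneg := hle (-e) (by rwa [norm_neg])
  rw [map_neg] at hneg
  exact abs_le.2 ⟨by linarith, hle e he⟩

lemma PointwiseTwiceDifferentiableAt.differentiableAt_subgradient
    (hφ : PointwiseTwiceDifferentiableAt φ x) (hp : ∀ y z, p y (z - y) ≤ φ z - φ y) :
    DifferentiableAt ℝ p x := by
  obtain ⟨L, B, hB⟩ := hφ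
  exact (hasFDerivAt_subgradient_of_secondOrder hp hB).differentiableAt

end Subgradient

end SecondOrder

section NearestPoints

variable {E : Type*} [NormedAddCommGroup E] [InnerProductSpace ℝ E] {K : Set E} {a b y z : E}

lemma mem_nearestPoints_iff_inner_le_zero (hK : Convex ℝ K) :
    a ∈ nearestPoints K y ↔ a ∈ K ∧ ∀ z ∈ K, inner ℝ (y - a) (z - a) ≤ 0 :=
  and_congr_right fun ha => by
    simp only [infDist_eq_iInf, dist_eq_norm, norm_eq_iInf_iff_real_inner_le_zero hK ha]

lemma norm_sub_le_of_mem_nearestPoints (hK : Convex ℝ K) (ha : a ∈ nearestPoints K y)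
    (hb : b ∈ nearestPoints K z) : ‖a - b‖ ≤ ‖y - z‖ := by
  rw [mem_nearestPoints_iff_inner_le_zero hK] at ha hb
  have hsq : ‖a - b‖ * ‖a - b‖ ≤ ‖y - z‖ * ‖a - b‖ := by
    calc ‖a - b‖ * ‖a - b‖
        = inner ℝ (y - z) (a - b) + inner ℝ (y - a) (b - a) + inner ℝ (z - b) (a - b) := by
          rw [← real_inner_self_eq_norm_mul_norm, ← neg_sub a b, inner_neg_right,
            ← sub_eq_add_neg, ← inner_sub_left, ← inner_add_left]
          congr 1
          abel
      _ ≤ inner ℝ (y - z) (a - b) := by linarith [ha.2 b hb.1, hb.2 a ha.1]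
      _ ≤ ‖y - z‖ * ‖a - b‖ := real_inner_le_norm _ _
  nlinarith [norm_nonneg (a - b), norm_nonneg (y - z)]

lemma eq_of_mem_nearestPoints (hK : Convex ℝ K) (ha : a ∈ nearestPoints K y)
    (hb : b ∈ nearestPoints K y) : a = b := by
  simpa [sub_eq_zero] using norm_sub_le_of_mem_nearestPoints hK ha hb

lemma nearestPoints_eq_singleton (hK : Convex ℝ K) (ha : a ∈ nearestPoints K y) :
    nearestPoints K y = {a} :=
  eq_singleton_iff_unique_mem.2 ⟨ha, fun _ hb => eq_of_mem_nearestPoints hK hb ha⟩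

lemma lipschitzWith_one_of_forall_mem_nearestPoints {ξ : E → E} (hK : Convex ℝ K)
    (hξ : ∀ y, ξ y ∈ nearestPoints K y) : LipschitzWith 1 ξ :=
  .of_dist_le_mul fun y z => by
    simpa [dist_eq_norm] using norm_sub_le_of_mem_nearestPoints hK (hξ y) (hξ z)

lemma nonempty_nearestPoints (hK : Convex ℝ K) (hc : IsComplete K) (hne : K.Nonempty) (y : E) :
    (nearestPoints K y).Nonempty := by
  obtain ⟨a, ha, hya⟩ := exists_norm_eq_iInf_of_complete_convex hne hc hK y
  exact ⟨a, ha, by simpa only [infDist_eq_iInf, dist_eq_norm] using hya⟩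

/-- The squared distance function is convex, with `y - a` as a subgradient at `y`. -/
lemma inner_sub_le_infDist_sq_sub (hK : Convex ℝ K) (ha : a ∈ nearestPoints K y) (z : E) :
    inner ℝ (y - a) (z - y) ≤ infDist z K ^ 2 / 2 - infDist y K ^ 2 / 2 := by
  have hbound (w : E) (hw : w ∈ K) :
      2 * inner ℝ (y - a) (z - y) + infDist y K ^ 2 ≤ dist z w ^ 2 := by
    have hsupport := ((mem_nearestPoints_iff_inner_le_zero hK).1 ha).2 w hw
    have hexpand : ‖(z - w) - (y - a)‖ ^ 2 =
        ‖z - w‖ ^ 2 - 2 * inner ℝ (y - a) (z - w) + ‖y - a‖ ^ 2 := by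
      rw [norm_sub_sq_real, real_inner_comm]
    have hsplit : z - w = (z - y) + (y - a) - (w - a) := by abel
    rw [dist_eq_norm, ← ha.2]
    have hinner : inner ℝ (y - a) (z - w) =
        inner ℝ (y - a) (z - y) + ‖y - a‖ ^ 2 - inner ℝ (y - a) (w - a) := by
      rw [hsplit, inner_sub_right, inner_add_right, real_inner_self_eq_norm_sq]
    nlinarith [sq_nonneg ‖(z - w) - (y - a)‖, hexpand]
  have hsqrt := (le_infDist (x := z) ⟨a, ha.1⟩).2 fun w hw =>
    (Real.sqrt_le_left dist_nonneg).2 (hbound w hw)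
  rw [Real.sqrt_le_left infDist_nonneg] at hsqrt
  linarith

lemma mem_frontier_of_mem_nearestPoints (hK : Convex ℝ K) (hy : y ∉ K)
    (ha : a ∈ nearestPoints K y) : a ∈ frontier K := by
  refine ⟨subset_closure ha.1, fun hint => hy ?_⟩
  have hline : Tendsto (fun t : ℝ => a + t • (y - a)) (𝓝[>] 0) (𝓝 a) := by
    refine tendsto_nhdsWithin_of_tendsto_nhds ?_
    simpa using (by fun_prop : Continuous fun t : ℝ => a + t • (y - a)).tendsto 0
  obtain ⟨t, htK, ht⟩ :=
    ((hline.eventually (mem_interior_iff_mem_nhds.1 hint)).and self_mem_nhdsWithin).exists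
  have hinner := ((mem_nearestPoints_iff_inner_le_zero hK).1 ha).2 _ htK
  rw [add_sub_cancel_left, inner_smul_right, real_inner_self_eq_norm_sq] at hinner
  have hya : ‖y - a‖ = 0 := by
    by_contra hne
    exact hinner.not_gt (mul_pos ht (by positivity))
  rw [sub_eq_zero.1 (norm_eq_zero.1 hya)]
  exact ha.1

/-- The subgradient `y - ξ_K(y)` of `δ_K ^ 2 / 2` is differentiable wherever `δ_K` has a
second-order expansion. -/
theorem nonDirDiffPoints_subset_Sigma2 [CompleteSpace E] (hK : Convex ℝ K) (hcl : IsClosed K)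
    (hne : K.Nonempty) : nonDirDiffPoints K ⊆ Sigma2 K := by
  refine fun x hx => ⟨hx.1, fun h2 => hx.2 ?_⟩
  choose ξ hξ using nonempty_nearestPoints hK hcl.isComplete hne
  let riesz : E ≃L[ℝ] StrongDual ℝ E := (InnerProductSpace.toDual ℝ E).toContinuousLinearEquiv
  have hsub (y z : E) :
      riesz (y - ξ y) (z - y) ≤ infDist z K ^ 2 / 2 - infDist y K ^ 2 / 2 :=
    inner_sub_le_infDist_sq_sub hK (hξ y) z
  have hdiff : DifferentiableAt ℝ (fun y => y - ξ y) x := by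
    simpa only [Function.comp_def, ContinuousLinearEquiv.symm_apply_apply] using
      riesz.symm.differentiableAt.comp x (h2.sq_div_two.differentiableAt_subgradient hsub)
  have hξx : DifferentiableAt ℝ ξ x := by simpa using differentiableAt_id.sub hdiff
  rw [multiDirDifferentiableAt_iff_of_eq_singleton fun y => nearestPoints_eq_singleton hK (hξ y)]
  intro v
  have hline : DifferentiableAt ℝ (fun t : ℝ => x + t • v) 0 := by fun_prop
  exact (DifferentiableAt.comp (0 : ℝ) (by simpa using hξx) hline).differentiableWithinAt

end NearestPoints

lemma Plane.inner_eq (u v : Plane) : inner ℝ u v = u 0 * v 0 + u 1 * v 1 := by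
  simp [PiLp.inner_apply, Fin.sum_univ_two, mul_comm]

lemma Plane.hasDerivAt_mk {a b : ℝ → ℝ} {a' b' x : ℝ} (ha : HasDerivAt a a' x)
    (hb : HasDerivAt b b' x) : HasDerivAt (fun t => (!₂[a t, b t] : Plane)) !₂[a', b'] x := by
  have hpi : HasDerivAt (fun t => ![a t, b t]) ![a', b'] x :=
    hasDerivAt_pi.2 fun i => by fin_cases i <;> assumption
  exact (PiLp.hasFDerivAt_toLp (𝕜 := ℝ) 2 _).comp_hasDerivAt x hpi

/-- The downward normal vector of a line of slope `m`; it has length `√(1 + m ^ 2)`. -/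
noncomputable def slopeNormal (m : ℝ) : Plane := !₂[m, -1]

/-- The direction vector of a line of slope `m`, with first coordinate `1`. -/
noncomputable def slopeTangent (m : ℝ) : Plane := !₂[1, m]

/-- The downward unit normal vector of a line of slope `m`. -/
noncomputable def slopeUnitNormal (m : ℝ) : Plane := NormedSpace.normalize (slopeNormal m)

@[simp] lemma slopeNormal_zero (m : ℝ) : slopeNormal m 0 = m := rfl

@[simp] lemma slopeNormal_one (m : ℝ) : slopeNormal m 1 = -1 := rfl

@[simp] lemma slopeTangent_zero (m : ℝ) : slopeTangent m 0 = 1 := rfl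

@[simp] lemma slopeTangent_one (m : ℝ) : slopeTangent m 1 = m := rfl

lemma norm_slopeNormal (m : ℝ) : ‖slopeNormal m‖ = √(1 + m ^ 2) := by
  simp [EuclideanSpace.norm_eq, Fin.sum_univ_two, add_comm]

lemma norm_slopeNormal_pos (m : ℝ) : 0 < ‖slopeNormal m‖ := by
  rw [norm_slopeNormal]
  positivity

lemma norm_slopeUnitNormal (m : ℝ) : ‖slopeUnitNormal m‖ = 1 :=
  NormedSpace.norm_normalize_eq_one_iff.2 (norm_pos_iff.1 (norm_slopeNormal_pos m))

lemma contDiff_slopeUnitNormal {n : WithTop ℕ∞} : ContDiff ℝ n slopeUnitNormal := by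
  have hnormal : ContDiff ℝ n slopeNormal := contDiff_euclidean.2 fun i => by
    fin_cases i
    exacts [contDiff_id, contDiff_const]
  have hne (m : ℝ) : slopeNormal m ≠ 0 := norm_pos_iff.1 (norm_slopeNormal_pos m)
  exact ((hnormal.norm ℝ hne).inv fun m => norm_ne_zero_iff.2 (hne m)).smul hnormal

lemma hasDerivAt_slopeUnitNormal (m : ℝ) :
    HasDerivAt slopeUnitNormal ((‖slopeNormal m‖ ^ 3)⁻¹ • slopeTangent m) m := by
  have hpos : 0 < 1 + m ^ 2 := by positivity
  have hnormal : HasDerivAt slopeNormal !₂[1, 0] m :=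
    Plane.hasDerivAt_mk (hasDerivAt_id m) (hasDerivAt_const m (-1))
  have hsqrt : HasDerivAt (fun t : ℝ => √(1 + t ^ 2)) (m / √(1 + m ^ 2)) m := by
    convert! (((hasDerivAt_id m).pow 2).const_add 1).sqrt hpos.ne' using 1
    simp only [Nat.cast_ofNat, id_eq, Nat.add_one_sub_one, pow_one, mul_one, Pi.pow_apply]
    field_simp
  have hsq : √(1 + m ^ 2) ^ 2 = 1 + m ^ 2 := Real.sq_sqrt hpos.le
  have hunit := (hsqrt.fun_inv (Real.sqrt_pos.2 hpos).ne').smul hnormal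
  simp only [← norm_slopeNormal] at hunit hsq
  refine hunit.congr_deriv ?_
  have := norm_slopeNormal_pos m
  ext i
  fin_cases i
  · simp only [Fin.zero_eta, PiLp.add_apply, PiLp.smul_apply, Matrix.cons_val_zero, smul_eq_mul,
      mul_one, slopeNormal_zero, slopeTangent_zero]
    field_simp
    linarith
  · simp only [Fin.mk_one, PiLp.add_apply, PiLp.smul_apply, Matrix.cons_val_one,
      Matrix.cons_val_fin_one, smul_eq_mul, mul_zero, slopeNormal_one, mul_neg, mul_one, zero_add,
      slopeTangent_one]
    field_simp

/-- The epigraph `{(x, y) | g x ≤ y}` in the Euclidean plane. -/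
def planeEpigraph (g : ℝ → ℝ) : Set Plane := {z | g (z 0) ≤ z 1}

/-- The point of the graph of `g` with abscissa `x`. -/
noncomputable def graphPoint (g : ℝ → ℝ) (x : ℝ) : Plane := !₂[x, g x]

section Epigraph

variable {g : ℝ → ℝ} {x r ρ : ℝ} {y : Plane}

@[simp] lemma graphPoint_zero (g : ℝ → ℝ) (x : ℝ) : graphPoint g x 0 = x := rfl

@[simp] lemma graphPoint_one (g : ℝ → ℝ) (x : ℝ) : graphPoint g x 1 = g x := rfl

lemma mem_planeEpigraph : y ∈ planeEpigraph g ↔ g (y 0) ≤ y 1 := Iff.rfl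

lemma graphPoint_mem_planeEpigraph (g : ℝ → ℝ) (x : ℝ) : graphPoint g x ∈ planeEpigraph g :=
  le_refl (g x)

lemma isClosed_planeEpigraph (hg : Continuous g) : IsClosed (planeEpigraph g) :=
  isClosed_le (by fun_prop) (by fun_prop)

lemma convex_planeEpigraph (hconv : ConvexOn ℝ univ g) : Convex ℝ (planeEpigraph g) := by
  intro z hz w hw a b ha hb hab
  rw [mem_planeEpigraph] at hz hw ⊢
  calc g (a • z 0 + b • w 0) ≤ a • g (z 0) + b • g (w 0) :=
        hconv.2 (mem_univ _) (mem_univ _) ha hb hab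
    _ ≤ a • z 1 + b • w 1 := by gcongr

lemma hasC11Boundary_planeEpigraph (hg : IsC11 g) : HasC11Boundary (planeEpigraph g) :=
  fun _ _ => ⟨.refl ℝ Plane, g, hg, .of_forall fun _ => Iff.rfl⟩

lemma frontier_planeEpigraph (hg : Continuous g) :
    frontier (planeEpigraph g) = range (graphPoint g) := by
  have hrange : range (graphPoint g) = {z : Plane | g (z 0) = z 1} := by
    ext z
    refine ⟨?_, fun hz => ⟨z 0, ?_⟩⟩
    · rintro ⟨x, rfl⟩
      rfl
    · ext i
      fin_cases i
      exacts [rfl, hz]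
  rw [hrange]
  refine (frontier_le_subset_eq (by fun_prop) (by fun_prop)).antisymm fun z hz => ?_
  have hz : g (z 0) = z 1 := hz
  rw [frontier_eq_closure_inter_closure]
  refine ⟨subset_closure hz.le, ?_⟩
  have hbelow : Tendsto (fun t : ℝ => z + t • slopeNormal 0) (𝓝[>] 0) (𝓝 z) := by
    refine tendsto_nhdsWithin_of_tendsto_nhds ?_
    simpa using (by fun_prop : Continuous fun t : ℝ => z + t • slopeNormal 0).tendsto 0
  refine mem_closure_of_tendsto hbelow ?_
  filter_upwards [self_mem_nhdsWithin] with t (ht : 0 < t)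
  simp [hz, ht]

lemma contDiff_graphPoint {n : WithTop ℕ∞} (hg : ContDiff ℝ n g) : ContDiff ℝ n (graphPoint g) :=
  contDiff_euclidean.2 fun i => by
    fin_cases i
    exacts [contDiff_id, hg]

lemma hasDerivAt_graphPoint (hg : DifferentiableAt ℝ g x) :
    HasDerivAt (graphPoint g) (slopeTangent (deriv g x)) x :=
  Plane.hasDerivAt_mk (hasDerivAt_id x) hg.hasDerivAt

lemma add_deriv_mul_sub_le (hconv : ConvexOn ℝ univ g) (hg : DifferentiableAt ℝ g x) (y : ℝ) :
    g x + deriv g x * (y - x) ≤ g y := by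
  rcases lt_trichotomy x y with hxy | rfl | hyx
  · have hslope := hconv.deriv_le_slope (mem_univ x) (mem_univ y) hxy hg
    rw [slope_def_field, le_div_iff₀ (sub_pos.2 hxy)] at hslope
    linarith
  · simp
  · have hslope := hconv.slope_le_deriv (mem_univ y) (mem_univ x) hyx hg
    rw [slope_def_field, div_le_iff₀ (sub_pos.2 hyx)] at hslope
    linarith

lemma graphPoint_mem_nearestPoints_add_smul_slopeNormal (hconv : ConvexOn ℝ univ g)
    (hg : DifferentiableAt ℝ g x) (hρ : 0 ≤ ρ) : graphPoint g x ∈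
      nearestPoints (planeEpigraph g) (graphPoint g x + ρ • slopeNormal (deriv g x)) := by
  refine (mem_nearestPoints_iff_inner_le_zero (convex_planeEpigraph hconv)).2
    ⟨graphPoint_mem_planeEpigraph g x, fun z hz => ?_⟩
  have htangent : deriv g x * (z 0 - x) - (z 1 - g x) ≤ 0 := by
    linarith [(add_deriv_mul_sub_le hconv hg (z 0)).trans hz]
  rw [add_sub_cancel_left, inner_smul_left, Plane.inner_eq]
  refine mul_nonpos_of_nonneg_of_nonpos hρ (htangent.trans_eq' ?_)
  simp only [slopeNormal_zero, PiLp.sub_apply, graphPoint_zero, slopeNormal_one, graphPoint_one,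
    neg_mul, one_mul, neg_sub]
  ring

lemma graphPoint_mem_nearestPoints_add_smul_slopeUnitNormal (hconv : ConvexOn ℝ univ g)
    (hg : DifferentiableAt ℝ g x) (hr : 0 ≤ r) : graphPoint g x ∈
      nearestPoints (planeEpigraph g) (graphPoint g x + r • slopeUnitNormal (deriv g x)) := by
  rw [slopeUnitNormal, NormedSpace.normalize, smul_smul]
  exact graphPoint_mem_nearestPoints_add_smul_slopeNormal hconv hg (by positivity)

lemma infDist_add_smul_slopeUnitNormal (hconv : ConvexOn ℝ univ g) (hg : DifferentiableAt ℝ g x)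
    (hr : 0 ≤ r) :
    infDist (graphPoint g x + r • slopeUnitNormal (deriv g x)) (planeEpigraph g) = r := by
  rw [← (graphPoint_mem_nearestPoints_add_smul_slopeUnitNormal hconv hg hr).2,
    add_sub_cancel_left, norm_smul, norm_slopeUnitNormal, mul_one, Real.norm_of_nonneg hr]

lemma exists_eq_add_smul_slopeNormal (hconv : ConvexOn ℝ univ g) (hg : DifferentiableAt ℝ g x)
    (hy : y ∉ planeEpigraph g) (hx : graphPoint g x ∈ nearestPoints (planeEpigraph g) y) :
    ∃ ρ : ℝ, 0 < ρ ∧ y = graphPoint g x + ρ • slopeNormal (deriv g x) := by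
  have hinner := ((mem_nearestPoints_iff_inner_le_zero (convex_planeEpigraph hconv)).1 hx).2
  have hmax : IsLocalMax (fun t => inner ℝ (y - graphPoint g x) (graphPoint g t - graphPoint g x))
      x := .of_forall fun t => by
    simpa using hinner _ (graphPoint_mem_planeEpigraph g t)
  have horth : inner ℝ (y - graphPoint g x) (slopeTangent (deriv g x)) = 0 := by
    have := hmax.hasDerivAt_eq_zero
      ((hasDerivAt_const x _).inner ℝ ((hasDerivAt_graphPoint hg).sub_const _))
    simpa using this
  have hbelow : y 1 - g x ≤ 0 := by
    simpa [Plane.inner_eq] using hinner !₂[x, g x + 1] (by simp [mem_planeEpigraph])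
  have hy_eq : y = graphPoint g x + (g x - y 1) • slopeNormal (deriv g x) := by
    simp only [Plane.inner_eq, PiLp.sub_apply, graphPoint_zero, graphPoint_one,
      slopeTangent_zero, slopeTangent_one, mul_one] at horth
    ext i
    fin_cases i
    · simp only [Fin.zero_eta, PiLp.add_apply, graphPoint_zero, PiLp.smul_apply, slopeNormal_zero,
        smul_eq_mul]
      linarith
    · simp
  refine ⟨g x - y 1, lt_of_le_of_ne (by linarith) fun h0 => hy ?_, hy_eq⟩
  rw [hy_eq, ← h0, zero_smul, add_zero]
  exact graphPoint_mem_planeEpigraph g x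

lemma notMem_planeEpigraph_of_tangent (hconv : ConvexOn ℝ univ g) (hg : DifferentiableAt ℝ g x)
    (hρ : 0 < ρ) (t : ℝ) :
    graphPoint g x + ρ • slopeNormal (deriv g x) + t • slopeTangent (deriv g x) ∉
      planeEpigraph g := by
  have htangent := add_deriv_mul_sub_le hconv hg (x + ρ * deriv g x + t)
  simp only [mem_planeEpigraph, not_le, PiLp.add_apply, PiLp.smul_apply, smul_eq_mul,
    graphPoint_zero, graphPoint_one, slopeNormal_zero, slopeNormal_one, slopeTangent_zero,
    slopeTangent_one, mul_one]
  nlinarith [mul_nonneg hρ.le (sq_nonneg (deriv g x))]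

end Epigraph

section LevelSets

lemma MultiDifferentiableAt.exists_hasDerivWithinAt_sub {E F : Type*} [NormedAddCommGroup E]
    [NormedSpace ℝ E] [NormedAddCommGroup F] [NormedSpace ℝ F] {T : E → Set F} {q : ℝ → E}
    {γ : ℝ → F} {s : Set ℝ} {x : ℝ} (hT : ∀ y, T (q y) = {γ y})
    (h : MultiDifferentiableAt T (q x)) (hq : (fun y => q y - q x) =O[𝓝[s] x] fun y => y - x) :
    ∃ L : E →L[ℝ] F, HasDerivWithinAt (fun y => γ y - L (q y)) 0 s x := by
  obtain ⟨p, hp, L, hL⟩ := h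
  obtain rfl : γ x = p := singleton_injective ((hT x).symm.trans hp)
  have hq0 : Tendsto (fun y => q y - q x) (𝓝[s] x) (𝓝 0) := by
    refine hq.trans_tendsto (tendsto_nhdsWithin_of_tendsto_nhds ?_)
    simpa using (by fun_prop : Continuous fun y : ℝ => y - x).tendsto x
  have hlin : (fun y => γ y - γ x - L (q y - q x)) =o[𝓝[s] x] fun y => q y - q x := by
    refine IsLittleO.of_bound fun ε hε => ?_
    obtain ⟨δ, hδ, hbound⟩ := hL ε hε
    filter_upwards [hq0.norm.eventually_le_const (by simpa using hδ)] with y hy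
    exact hbound (q y) hy _ (hT y ▸ rfl)
  refine ⟨L, hasDerivWithinAt_iff_isLittleO.2 ((hlin.trans_isBigO hq).congr_left fun y => ?_)⟩
  rw [map_sub]
  module

variable {C : NNReal} {x : ℝ} {s : Set ℝ}

lemma isBigO_sub_of_lipschitzWith {F : ℝ → ℝ} (hF : LipschitzWith C F) :
    (fun y => F y - F x) =O[𝓝[s] x] fun y => y - x :=
  .of_bound C (.of_forall fun y => by simpa [← dist_eq_norm] using hF.dist_le_mul y x)

lemma hasDerivWithinAt_comp_sub_smul {E : Type*} [NormedAddCommGroup E] [NormedSpace ℝ E]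
    {h : ℝ → E} {h' : E} {F : ℝ → ℝ} (hh : HasDerivAt h h' (F x)) (hF : LipschitzWith C F) :
    HasDerivWithinAt (fun y => h (F y) - F y • h') 0 s x := by
  refine hasDerivWithinAt_iff_isLittleO.2 ((((hasDerivAt_iff_isLittleO.1 hh).comp_tendsto
    hF.continuous.continuousWithinAt).trans_isBigO (isBigO_sub_of_lipschitzWith hF)).congr_left
      fun y => ?_)
  simp only [Function.comp_apply]
  module

variable {g : ℝ → ℝ} {r : ℝ}

lemma hasDerivWithinAt_levelCurve_sub (hg : DifferentiableAt ℝ g x)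
    (hL : LipschitzWith C (deriv g)) :
    HasDerivWithinAt (fun y => graphPoint g y + r • slopeUnitNormal (deriv g y) -
      (r * (‖slopeNormal (deriv g x)‖ ^ 3)⁻¹ * deriv g y) • slopeTangent (deriv g x))
      (slopeTangent (deriv g x)) s x := by
  convert! (hasDerivAt_graphPoint hg).hasDerivWithinAt.add
    ((hasDerivWithinAt_comp_sub_smul (hasDerivAt_slopeUnitNormal _) hL).const_smul r) using 1
  · ext1 y
    simp only [Pi.add_apply, Pi.smul_apply]
    module
  · module

lemma isBigO_levelCurve_sub (hg : DifferentiableAt ℝ g x) (hL : LipschitzWith C (deriv g)) :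
    (fun y => graphPoint g y + r • slopeUnitNormal (deriv g y) -
      (graphPoint g x + r • slopeUnitNormal (deriv g x))) =O[𝓝[s] x] fun y => y - x := by
  set τ := slopeTangent (deriv g x)
  set κ := (‖slopeNormal (deriv g x)‖ ^ 3)⁻¹
  have hτ : (fun y => (r * κ * (deriv g y - deriv g x)) • τ) =O[𝓝[s] x] fun y => y - x := by
    simpa using ((isBigO_sub_of_lipschitzWith hL).const_mul_left (r * κ)).smul
      (isBigO_const_const τ (one_ne_zero (α := ℝ)) _)
  refine ((hasDerivWithinAt_levelCurve_sub (r := r) hg hL).hasFDerivWithinAt.isBigO_sub.add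
    hτ).congr_left fun y => ?_
  module

/-- With `q y` the point of the level set over `graphPoint g y`, the derivative `L` would satisfy
`L (q y) = graphPoint g y` to first order at `x`. Since `q y` is a multiple of `deriv g y` in the
tangent direction up to a differentiable function, `deriv g` would be differentiable. -/
theorem not_multiDifferentiableAt_distLevel (hconv : ConvexOn ℝ univ g) (hg : Differentiable ℝ g)
    (hL : LipschitzWith C (deriv g)) (hr : 0 < r) (hx : x ∈ rightSingularSet (deriv g)) :
    ¬ MultiDifferentiableAt
      (multiRestrict (nearestPoints (planeEpigraph g)) (distLevel (planeEpigraph g) r))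
      (graphPoint g x + r • slopeUnitNormal (deriv g x)) := by
  intro hdiff
  set q : ℝ → Plane := fun y => graphPoint g y + r • slopeUnitNormal (deriv g y) with hq
  have hT (y : ℝ) : multiRestrict (nearestPoints (planeEpigraph g))
      (distLevel (planeEpigraph g) r) (q y) = {graphPoint g y} := by
    rw [← nearestPoints_eq_singleton (convex_planeEpigraph hconv)
      (graphPoint_mem_nearestPoints_add_smul_slopeUnitNormal hconv (hg y) hr.le)]
    exact ext fun z => and_iff_right (infDist_add_smul_slopeUnitNormal hconv (hg y) hr.le)
  obtain ⟨L, hLq⟩ := MultiDifferentiableAt.exists_hasDerivWithinAt_sub hT hdiff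
    (isBigO_levelCurve_sub (s := Ioi x) (hg x) hL)
  set τ := slopeTangent (deriv g x)
  set κ := (‖slopeNormal (deriv g x)‖ ^ 3)⁻¹
  have hκ : 0 < κ := inv_pos.2 (pow_pos (norm_slopeNormal_pos _) 3)
  let L₀ : Plane →L[ℝ] ℝ := (EuclideanSpace.proj (0 : Fin 2)).comp L
  have hfirst : HasDerivWithinAt (fun y => y - L₀ (q y)) 0 (Ioi x) x :=
    (EuclideanSpace.proj (𝕜 := ℝ) (0 : Fin 2)).hasFDerivAt.comp_hasDerivWithinAt x hLq
  have hslope : HasDerivWithinAt (fun y => r * κ * L₀ τ * deriv g y) (1 - L₀ τ) (Ioi x) x := by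
    convert! ((hasDerivWithinAt_id x (Ioi x)).sub hfirst).sub
      (L₀.hasFDerivAt.comp_hasDerivWithinAt x (hasDerivWithinAt_levelCurve_sub (hg x) hL)) using 1
    · ext1 y
      simp only [hq, map_add, map_smul, smul_eq_mul, Pi.sub_apply, id_eq, sub_sub_cancel,
        Function.comp_apply, map_sub, κ, τ]
      ring
    · simp [τ]
  rcases eq_or_ne (L₀ τ) 0 with h0 | h0
  · simp only [h0, mul_zero, zero_mul, sub_zero] at hslope
    exact one_ne_zero ((uniqueDiffWithinAt_Ioi x).eq_deriv _ hslope (hasDerivWithinAt_const ..))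
  · have hdiv := (hslope.const_mul (r * κ * L₀ τ)⁻¹).differentiableWithinAt
    simp only [inv_mul_cancel_left₀ (show r * κ * L₀ τ ≠ 0 by positivity)] at hdiv
    exact hx hdiv

end LevelSets

section RightDerivative

variable {F X : ℝ → ℝ} {a k w : ℝ}

lemma nhdsGT_le_map_nhdsGT (hX : Continuous X) (hfreq : ∃ᶠ t in 𝓝[>] a, X a < X t) :
    𝓝[>] (X a) ≤ map X (𝓝[>] a) := by
  intro s hs
  obtain ⟨b, hab, hb⟩ := mem_nhdsGT_iff_exists_Ioo_subset.1 (mem_map.1 hs)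
  obtain ⟨t, ht, hat, htb⟩ := (hfreq.and_eventually (Ioo_mem_nhdsGT hab)).exists
  filter_upwards [Ioo_mem_nhdsGT ht] with y hy
  obtain ⟨u, hu, rfl⟩ := intermediate_value_Ioo hat.le hX.continuousOn hy
  exact hb ⟨hu.1, hu.2.trans htb⟩

/-- A chain rule for a right derivative of the outer function: `X` runs through a right
neighbourhood of `X a`. -/
lemma hasDerivWithinAt_Ioi_of_comp (hX : Continuous X) (hXw : HasDerivWithinAt X w (Ioi a) a)
    (hw : 0 < w) (hFX : HasDerivWithinAt (F ∘ X) k (Ioi a) a) :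
    HasDerivWithinAt F (k / w) (Ioi (X a)) (X a) := by
  rw [hasDerivWithinAt_iff_tendsto_slope' self_notMem_Ioi] at hXw hFX ⊢
  have hpos : ∀ᶠ t in 𝓝[>] a, X a < X t := by
    filter_upwards [hXw.eventually_const_lt hw, self_mem_nhdsWithin] with t ht hat
    exact sub_pos.1 ((pos_iff_pos_of_mul_pos (by
      rwa [slope_def_field, div_eq_mul_inv] at ht)).2 (inv_pos.2 (sub_pos.2 hat)))
  refine (tendsto_map'_iff.2 ?_).mono_left (nhdsGT_le_map_nhdsGT hX hpos.frequently)
  refine (hFX.div hXw hw.ne').congr' ?_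
  filter_upwards [self_mem_nhdsWithin] with t (ht : a < t)
  simp only [Function.comp_apply, slope_def_field, Pi.div_apply]
  exact div_div_div_cancel_right₀ (sub_pos.2 ht).ne' _ _

lemma le_mul_max_of_hasDerivWithinAt_comp {C : NNReal} (hF : Monotone F) (hL : LipschitzWith C F)
    (hXw : HasDerivWithinAt X w (Ioi a) a) (hFX : HasDerivWithinAt (F ∘ X) k (Ioi a) a) :
    k ≤ C * max w 0 := by
  rw [hasDerivWithinAt_iff_tendsto_slope' self_notMem_Ioi] at hXw hFX
  refine le_of_tendsto_of_tendsto hFX ((hXw.max tendsto_const_nhds).const_mul _) ?_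
  filter_upwards [self_mem_nhdsWithin] with t (ht : a < t)
  have hat := sub_pos.2 ht
  rw [slope_def_field, slope_def_field, div_le_iff₀ hat, mul_assoc, max_mul_of_nonneg _ _ hat.le,
    div_mul_cancel₀ _ hat.ne', zero_mul]
  rcases le_total (X t) (X a) with hle | hle
  · exact (sub_nonpos.2 (hF hle)).trans (by positivity)
  · have hdist := (le_abs_self _).trans (hL.dist_le_mul (X t) (X a))
    rw [Real.dist_eq, abs_of_nonneg (sub_nonneg.2 hle)] at hdist
    exact hdist.trans (by gcongr; exact le_max_left _ _)

end RightDerivative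

section DirectionalDerivative

variable {g : ℝ → ℝ} {C : NNReal} {x ρ : ℝ}

/-- Moving off a normal line at unit speed in the tangent direction, the foot point has abscissa
`X t`, and the normal line through it is
`X t + σ t * g' (X t) = x + ρ * g' x + t`, `g (X t) - σ t = g x - ρ + t * g' x`.
Hence `g' (X t)` is a quotient of functions that are right differentiable if `X` is. -/
lemma hasDerivWithinAt_deriv_comp_of_normal {X σ : ℝ → ℝ} {w : ℝ} (hg : DifferentiableAt ℝ g x)
    (hX0 : X 0 = x) (hXw : HasDerivWithinAt X w (Ioi 0) 0) (hρ : 0 < ρ) (hσ : ∀ t, 0 < σ t)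
    (hfst : ∀ t, X t + σ t * deriv g (X t) = x + ρ * deriv g x + t)
    (hsnd : ∀ t, g (X t) - σ t = g x - ρ + t * deriv g x) :
    HasDerivWithinAt (deriv g ∘ X) ((1 - w) * (1 + deriv g x ^ 2) / ρ) (Ioi 0) 0 := by
  subst hX0
  set m := deriv g (X 0)
  have hσ_eq : σ = fun t => g (X t) - (g (X 0) - ρ + t * m) := by
    ext t
    linarith [hsnd t]
  have hslope_eq : deriv g ∘ X = fun t => (X 0 + ρ * m + t - X t) / σ t := by
    ext t
    rw [eq_div_iff (hσ t).ne', Function.comp_apply]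
    linarith [hfst t]
  have hσ0 : σ 0 = ρ := by simp [hσ_eq]
  have hσ' : HasDerivWithinAt σ (m * w - m) (Ioi 0) 0 := by
    rw [hσ_eq]
    refine ((hg.hasDerivAt.comp_hasDerivWithinAt 0 hXw).sub
      (((hasDerivWithinAt_id 0 (Ioi 0)).mul_const m).const_add (g (X 0) - ρ))).congr_deriv ?_
    rw [one_mul]
  have hnum : HasDerivWithinAt (fun t => X 0 + ρ * m + t - X t) (1 - w) (Ioi 0) 0 :=
    ((hasDerivWithinAt_id (0 : ℝ) (Ioi 0)).const_add _).sub hXw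
  rw [hslope_eq]
  refine (hnum.div hσ' (hσ 0).ne').congr_deriv ?_
  rw [hσ0]
  field_simp
  ring

lemma exists_normal_of_mem_nearestPoints (hconv : ConvexOn ℝ univ g) (hg : Differentiable ℝ g)
    {y a : Plane} (hy : y ∉ planeEpigraph g) (ha : a ∈ nearestPoints (planeEpigraph g) y) :
    ∃ s > 0, a 0 + s * deriv g (a 0) = y 0 ∧ g (a 0) - s = y 1 := by
  have hfr := mem_frontier_of_mem_nearestPoints (convex_planeEpigraph hconv) hy ha
  rw [frontier_planeEpigraph hg.continuous] at hfr
  obtain ⟨x, rfl⟩ := hfr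
  obtain ⟨ρ, hρ, rfl⟩ := exists_eq_add_smul_slopeNormal hconv (hg x) hy ha
  exact ⟨ρ, hρ, by simp [sub_eq_add_neg]⟩

lemma differentiableWithinAt_deriv_of_normal {X σ : ℝ → ℝ} (hconv : ConvexOn ℝ univ g)
    (hg : Differentiable ℝ g) (hL : LipschitzWith C (deriv g)) (hX0 : X 0 = x)
    (hXc : Continuous X) (hX : DifferentiableWithinAt ℝ X (Ioi 0) 0) (hρ : 0 < ρ)
    (hσ : ∀ t, 0 < σ t) (hfst : ∀ t, X t + σ t * deriv g (X t) = x + ρ * deriv g x + t)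
    (hsnd : ∀ t, g (X t) - σ t = g x - ρ + t * deriv g x) :
    DifferentiableWithinAt ℝ (deriv g) (Ioi x) x := by
  have hXw := hX.hasDerivWithinAt
  set w := derivWithin X (Ioi 0) 0
  have hcomp := hasDerivWithinAt_deriv_comp_of_normal (hg x) hX0 hXw hρ hσ hfst hsnd
  have hmono : Monotone (deriv g) := by
    simpa using hconv.monotoneOn_deriv fun x _ => hg x
  have hw : 0 < w := by
    by_contra! hw
    have hle := le_mul_max_of_hasDerivWithinAt_comp hmono hL hXw hcomp
    rw [max_eq_right hw, mul_zero] at hle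
    exact hle.not_gt (div_pos (mul_pos (by linarith) (by positivity)) hρ)
  rw [← hX0]
  exact (hasDerivWithinAt_Ioi_of_comp hXc hXw hw hcomp).differentiableWithinAt

theorem add_smul_slopeNormal_mem_nonDirDiffPoints (hconv : ConvexOn ℝ univ g)
    (hg : Differentiable ℝ g) (hL : LipschitzWith C (deriv g)) (hρ : 0 < ρ)
    (hx : x ∈ rightSingularSet (deriv g)) :
    graphPoint g x + ρ • slopeNormal (deriv g x) ∈ nonDirDiffPoints (planeEpigraph g) := by
  have hK := convex_planeEpigraph hconv
  refine ⟨by simpa using notMem_planeEpigraph_of_tangent hconv (hg x) hρ 0, fun hdir => hx ?_⟩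
  choose ξ hξ using nonempty_nearestPoints hK
    (isClosed_planeEpigraph hg.continuous).isComplete ⟨_, graphPoint_mem_planeEpigraph g 0⟩
  rw [multiDirDifferentiableAt_iff_of_eq_singleton
    fun y => nearestPoints_eq_singleton hK (hξ y)] at hdir
  set y : ℝ → Plane := fun t =>
    graphPoint g x + ρ • slopeNormal (deriv g x) + t • slopeTangent (deriv g x) with hy
  have hξy0 : ξ (y 0) = graphPoint g x :=
    eq_of_mem_nearestPoints hK (hξ _) (by
      simpa [hy] using graphPoint_mem_nearestPoints_add_smul_slopeNormal hconv (hg x) hρ.le)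
  choose σ hσ hfst hsnd using fun t => exists_normal_of_mem_nearestPoints hconv hg
    (notMem_planeEpigraph_of_tangent hconv (hg x) hρ t) (hξ (y t))
  have hξc : Continuous ξ := (lipschitzWith_one_of_forall_mem_nearestPoints hK hξ).continuous
  exact differentiableWithinAt_deriv_of_normal (X := fun t => ξ (y t) 0) hconv hg hL
    (by rw [hξy0, graphPoint_zero]) (by fun_prop)
    ((EuclideanSpace.proj (𝕜 := ℝ) (0 : Fin 2)).differentiableAt.comp_differentiableWithinAt 0
      (hdir (slopeTangent (deriv g x)))) hρ hσ (fun t => by simpa [hy] using hfst t)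
    (fun t => by simpa [hy, sub_eq_add_neg] using hsnd t)

end DirectionalDerivative

section HausdorffMeasure

variable {X : Type*} [MetricSpace X] [MeasurableSpace X] [BorelSpace X]

lemma hausdorffMeasure_one_image_eq_zero_of_locallyLipschitz {φ : ℝ → X}
    (hφ : LocallyLipschitz φ) {T : Set ℝ} (hT : volume T = 0) :
    Measure.hausdorffMeasure 1 (φ '' T) = 0 := by
  choose C t ht hC using hφ
  obtain ⟨s, hs, hcover⟩ := TopologicalSpace.countable_cover_nhds ht
  have hsub : φ '' T ⊆ ⋃ x ∈ s, φ '' (T ∩ t x) := by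
    rw [← image_iUnion₂, ← inter_iUnion₂, hcover, inter_univ]
  refine measure_mono_null hsub ((measure_biUnion_null_iff hs).2 fun x _ => ?_)
  have hnull : Measure.hausdorffMeasure 1 (T ∩ t x) = 0 := by
    rw [hausdorffMeasure_real]
    exact measure_mono_null inter_subset_left hT
  have himage := ((hC x).mono (inter_subset_right (s := T))).hausdorffMeasure_image_le zero_le_one
  rwa [hnull, mul_zero, nonpos_iff_eq_zero] at himage

lemma hausdorffMeasure_image_eq_top {φ : ℝ → X} {π : X → ℝ} {C : NNReal} {T : Set ℝ} {s : ℝ}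
    (hπ : LipschitzWith C π) (hπφ : Function.LeftInverse π φ) (hs0 : 0 ≤ s)
    (hsT : ENNReal.ofReal s < dimH T) : Measure.hausdorffMeasure s (φ '' T) = ⊤ := by
  lift s to NNReal using hs0
  rw [ENNReal.ofReal_coe_nnreal] at hsT
  refine hausdorffMeasure_of_lt_dimH (hsT.trans_le ?_)
  simpa only [hπφ.image_image] using hπ.dimH_image_le (φ '' T)

end HausdorffMeasure

lemma volume_rightSingularSet {F : ℝ → ℝ} {C : NNReal} (hF : LipschitzWith C F) :
    volume (rightSingularSet F) = 0 :=
  measure_mono_null (fun _ hx (h : DifferentiableAt ℝ F _) => hx h.differentiableWithinAt)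
    (ae_iff.1 hF.ae_differentiableAt_real)

/-- The point of the unit normal bundle of `planeEpigraph g` that lies over `graphPoint g x`. -/
noncomputable def graphNormal (g : ℝ → ℝ) (x : ℝ) : WithLp 2 (Plane × Plane) :=
  WithLp.toLp 2 (graphPoint g x, slopeUnitNormal (deriv g x))

section GraphNormal

variable {g : ℝ → ℝ} {T : Set ℝ} {s : ℝ}

lemma graphNormal_mem_unitNormalBundle (hconv : ConvexOn ℝ univ g) {x : ℝ}
    (hg : DifferentiableAt ℝ g x) : graphNormal g x ∈ unitNormalBundle (planeEpigraph g) :=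
  ⟨graphPoint_mem_planeEpigraph g x, norm_slopeUnitNormal _, 1, one_pos,
    infDist_add_smul_slopeUnitNormal hconv hg zero_le_one⟩

lemma eq_graphNormal_of_mem_unitNormalBundle (hconv : ConvexOn ℝ univ g) {x : ℝ}
    (hg : DifferentiableAt ℝ g x) {z : WithLp 2 (Plane × Plane)}
    (hz : z ∈ unitNormalBundle (planeEpigraph g)) (hx : z.fst = graphPoint g x) :
    z = graphNormal g x := by
  obtain ⟨hK, hu, s, hs, hdist⟩ := hz
  rw [hx] at hK hdist
  have hnot : graphPoint g x + s • z.snd ∉ planeEpigraph g := fun h =>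
    hs.ne' (hdist.symm.trans (infDist_zero_of_mem h))
  have hnear : graphPoint g x ∈ nearestPoints (planeEpigraph g) (graphPoint g x + s • z.snd) :=
    ⟨hK, by rw [hdist, add_sub_cancel_left, norm_smul, hu, mul_one, Real.norm_of_nonneg hs.le]⟩
  obtain ⟨ρ, hρ, heq⟩ := exists_eq_add_smul_slopeNormal hconv hg hnot hnear
  have hsnd : z.snd = slopeUnitNormal (deriv g x) := by
    rw [slopeUnitNormal, ← NormedSpace.normalize_smul_of_pos hρ, ← add_left_cancel heq,
      NormedSpace.normalize_smul_of_pos hs, NormedSpace.normalize_eq_self_of_norm_eq_one hu]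
  rw [graphNormal, ← hx, ← hsnd]
  rfl

lemma unitNormalBundleOver_image_graphPoint (hconv : ConvexOn ℝ univ g)
    (hg : Differentiable ℝ g) (T : Set ℝ) :
    unitNormalBundleOver (planeEpigraph g) (graphPoint g '' T) = graphNormal g '' T := by
  ext z
  constructor
  · rintro ⟨hz, x, hx, hxz⟩
    exact ⟨x, hx, (eq_graphNormal_of_mem_unitNormalBundle hconv (hg x) hz hxz.symm).symm⟩
  · rintro ⟨x, hx, rfl⟩
    exact ⟨graphNormal_mem_unitNormalBundle hconv (hg x), x, hx, rfl⟩

lemma locallyLipschitz_graphPoint (hg : IsC11 g) : LocallyLipschitz (graphPoint g) := by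
  obtain ⟨hdiff, L, hL⟩ := hg
  exact (contDiff_graphPoint (contDiff_one_iff_deriv.2 ⟨hdiff, hL.continuous⟩)).locallyLipschitz

lemma locallyLipschitz_graphNormal (hg : IsC11 g) : LocallyLipschitz (graphNormal g) := by
  obtain ⟨L, hL⟩ := hg.2
  exact (WithLp.prodContinuousLinearEquiv 2 ℝ Plane Plane).symm.lipschitz.locallyLipschitz.comp
    ((locallyLipschitz_graphPoint hg).prodMk
      ((contDiff_slopeUnitNormal.locallyLipschitz (𝕂 := ℝ)).comp hL.locallyLipschitz))

lemma hausdorffMeasure_image_graphPoint_eq_top (hs0 : 0 ≤ s) (hsT : ENNReal.ofReal s < dimH T) :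
    Measure.hausdorffMeasure s (graphPoint g '' T) = ⊤ :=
  hausdorffMeasure_image_eq_top (EuclideanSpace.proj (𝕜 := ℝ) (0 : Fin 2)).lipschitz
    (fun _ => rfl) hs0 hsT

lemma hausdorffMeasure_image_graphNormal_eq_top (hs0 : 0 ≤ s) (hsT : ENNReal.ofReal s < dimH T) :
    Measure.hausdorffMeasure s (graphNormal g '' T) = ⊤ :=
  hausdorffMeasure_image_eq_top
    ((EuclideanSpace.proj (𝕜 := ℝ) (0 : Fin 2)).lipschitz.comp (LipschitzWith.prod_fst.comp
      (WithLp.prodContinuousLinearEquiv 2 ℝ Plane Plane).lipschitz)) (fun _ => rfl) hs0 hsT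

end GraphNormal

section SingularPoints

variable {g : ℝ → ℝ} {C : NNReal}

lemma frontier_planeEpigraph_subset_closure (hg : Continuous g) {T : Set ℝ} (hT : Dense T) :
    frontier (planeEpigraph g) ⊆ closure (graphPoint g '' T) := by
  rw [frontier_planeEpigraph hg]
  exact (contDiff_graphPoint (contDiff_zero.2 hg)).continuous.range_subset_closure_image_dense hT

lemma compl_subset_closure_nonDirDiffPoints (hconv : ConvexOn ℝ univ g)
    (hg : Differentiable ℝ g) (hL : LipschitzWith C (deriv g))
    (hdense : Dense (rightSingularSet (deriv g))) :
    (planeEpigraph g)ᶜ ⊆ closure (nonDirDiffPoints (planeEpigraph g)) := by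
  have hK := convex_planeEpigraph hconv
  intro y hy
  obtain ⟨a, ha⟩ := nonempty_nearestPoints hK (isClosed_planeEpigraph hg.continuous).isComplete
    ⟨_, graphPoint_mem_planeEpigraph g 0⟩ y
  have hfr := mem_frontier_of_mem_nearestPoints hK hy ha
  rw [frontier_planeEpigraph hg.continuous] at hfr
  obtain ⟨x, rfl⟩ := hfr
  obtain ⟨ρ, hρ, rfl⟩ := exists_eq_add_smul_slopeNormal hconv (hg x) hy ha
  have hcont : Continuous fun t => graphPoint g t + ρ • slopeNormal (deriv g t) := by
    have := hL.continuous
    have := hg.continuous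
    unfold graphPoint slopeNormal
    fun_prop
  exact map_mem_closure (f := fun t => graphPoint g t + ρ • slopeNormal (deriv g t)) hcont
    (hdense x) fun t ht => add_smul_slopeNormal_mem_nonDirDiffPoints hconv hg hL hρ ht

/-- The map `y ↦ (abscissa of ξ_K y, δ_K y)` is nonexpansive, and it maps the point at distance `r`
on the normal line over `graphPoint g x` to `(x, r)`. -/
lemma dimH_prod_Ioi_le_dimH_nonDirDiffPoints (hconv : ConvexOn ℝ univ g)
    (hg : Differentiable ℝ g) (hL : LipschitzWith C (deriv g)) :
    dimH (rightSingularSet (deriv g) ×ˢ Ioi (0 : ℝ)) ≤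
      dimH (nonDirDiffPoints (planeEpigraph g)) := by
  have hK := convex_planeEpigraph hconv
  choose ξ hξ using nonempty_nearestPoints hK
    (isClosed_planeEpigraph hg.continuous).isComplete ⟨_, graphPoint_mem_planeEpigraph g 0⟩
  have hlip : LipschitzWith _ fun y => (ξ y 0, infDist y (planeEpigraph g)) :=
    ((EuclideanSpace.proj (𝕜 := ℝ) (0 : Fin 2)).lipschitz.comp
      (lipschitzWith_one_of_forall_mem_nearestPoints hK hξ)).prodMk (lipschitz_infDist_pt _)
  refine (dimH_mono ?_).trans (hlip.dimH_image_le _)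
  rintro ⟨x, r⟩ ⟨hx, hr : 0 < r⟩
  refine ⟨graphPoint g x + r • slopeUnitNormal (deriv g x), ?_, Prod.ext ?_ ?_⟩
  · rw [slopeUnitNormal, NormedSpace.normalize, smul_smul]
    exact add_smul_slopeNormal_mem_nonDirDiffPoints hconv hg hL
      (mul_pos hr (inv_pos.2 (norm_slopeNormal_pos _))) hx
  · exact congr_arg (fun a : Plane => a 0) (eq_of_mem_nearestPoints hK (hξ _)
      (graphPoint_mem_nearestPoints_add_smul_slopeUnitNormal hconv (hg x) hr.le))
  · exact infDist_add_smul_slopeUnitNormal hconv (hg x) hr.le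

end SingularPoints

lemma Plane.dimH_eq_two_of_two_le {A : Set Plane} (hA : 2 ≤ dimH A) : dimH A = 2 :=
  le_antisymm ((dimH_mono (subset_univ A)).trans_eq (by simp [Real.dimH_univ_eq_finrank])) hA

lemma exists_convexOn_isC11_rightSingularSet_deriv :
    ∃ g : ℝ → ℝ, ConvexOn ℝ univ g ∧ IsC11 g ∧ Dense (rightSingularSet (deriv g)) ∧
      1 ≤ dimH (rightSingularSet (deriv g)) ∧
      2 ≤ dimH (rightSingularSet (deriv g) ×ˢ Ioi (0 : ℝ)) := by
  obtain ⟨F, hmono, ⟨L, hL⟩, hF⟩ := exists_monotone_lipschitzWith_rightSingularSet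
  obtain ⟨g, hg⟩ : ∃ g : ℝ → ℝ, ∀ x, HasDerivAt g (F x) x :=
    ⟨_, fun x => (hL.continuous.integral_hasStrictDerivAt 0 x).hasDerivAt⟩
  obtain rfl : deriv g = F := funext fun x => (hg x).deriv
  have hdiff : Differentiable ℝ g := fun x => (hg x).differentiableAt
  exact ⟨g, hmono.convexOn_univ_of_deriv hdiff, ⟨hdiff, L, hL⟩, hF⟩

theorem mainTheorem4 :
    ∃ K S : Set Plane,
      IsClosed K ∧ Convex ℝ K ∧ HasC11Boundary K ∧
      S ⊆ frontier K ∧ frontier K ⊆ closure S ∧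
      (Measure.hausdorffMeasure 1 S = 0 ∧
        ∀ s : ℝ, 0 ≤ s → s < 1 → Measure.hausdorffMeasure s S = ⊤) ∧
      (Measure.hausdorffMeasure 1 (unitNormalBundleOver K S) = 0 ∧
        ∀ s : ℝ, 0 ≤ s → s < 1 →
          Measure.hausdorffMeasure s (unitNormalBundleOver K S) = ⊤) ∧
      (∀ r : ℝ, 0 < r → ∀ z ∈ unitNormalBundleOver K S,
        ¬ MultiDifferentiableAt (multiRestrict (nearestPoints K) (distLevel K r))
          (z.fst + r • z.snd)) ∧
      (Kᶜ ⊆ closure (Sigma2 K) ∧ dimH (Sigma2 K) = 2) ∧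
      (Kᶜ ⊆ closure (nonDirDiffPoints K) ∧ dimH (nonDirDiffPoints K) = 2) := by
  obtain ⟨g, hconv, hC11, hdense, hdim1, hdim2⟩ := exists_convexOn_isC11_rightSingularSet_deriv
  obtain ⟨hg, L, hL⟩ := id hC11
  have hcl := isClosed_planeEpigraph hg.continuous
  have hK := convex_planeEpigraph hconv
  have hN := unitNormalBundleOver_image_graphPoint hconv hg (rightSingularSet (deriv g))
  have hnull := volume_rightSingularSet hL
  have hlt {s : ℝ} (hs : s < 1) : ENNReal.ofReal s < dimH (rightSingularSet (deriv g)) :=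
    (ENNReal.ofReal_lt_one.2 hs).trans_le hdim1
  have hsub := nonDirDiffPoints_subset_Sigma2 hK hcl ⟨_, graphPoint_mem_planeEpigraph g 0⟩
  have hclosure := compl_subset_closure_nonDirDiffPoints hconv hg hL hdense
  have hdim := hdim2.trans (dimH_prod_Ioi_le_dimH_nonDirDiffPoints hconv hg hL)
  refine ⟨planeEpigraph g, graphPoint g '' rightSingularSet (deriv g), hcl, hK,
    hasC11Boundary_planeEpigraph hC11,
    frontier_planeEpigraph hg.continuous ▸ image_subset_range _ _,
    frontier_planeEpigraph_subset_closure hg.continuous hdense,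
    ⟨hausdorffMeasure_one_image_eq_zero_of_locallyLipschitz
      (locallyLipschitz_graphPoint hC11) hnull,
      fun s hs0 hs1 => hausdorffMeasure_image_graphPoint_eq_top hs0 (hlt hs1)⟩,
    hN ▸ ⟨hausdorffMeasure_one_image_eq_zero_of_locallyLipschitz
      (locallyLipschitz_graphNormal hC11) hnull,
      fun s hs0 hs1 => hausdorffMeasure_image_graphNormal_eq_top hs0 (hlt hs1)⟩, ?_,
    ⟨hclosure.trans (closure_mono hsub),
      Plane.dimH_eq_two_of_two_le (hdim.trans (dimH_mono hsub))⟩,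
    ⟨hclosure, Plane.dimH_eq_two_of_two_le hdim⟩⟩
  rw [hN]
  rintro r hr _ ⟨x, hx, rfl⟩
  exact not_multiDifferentiableAt_distLevel hconv hg hL hr hx
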